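/- Let $n\in\mathbb N$, let $\mathbb K\in\{\mathbb R,\mathbb C\}$, and let $p,q:\mathbb R^n\to[1,\infty]$ be measurable exponents. For a measurable $f:\mathbb R^n\to\mathbb K$ put $$\varrho_{p(\cdot)}(f)=\int_{\{p<\infty\}}|f(x)|^{p(x)}\,dx+\|f\|_{L^\infty(\{p=\infty\})},$$ and for a sequence $f=(f_\nu)_{\nu}$ of measurable functions $\mathbb R^n\to\mathbb K$ put $$\varrho(f)=\sum_{\nu}\inf\Big\{\lambda>0:\ \varrho_{p(\cdot)}\big(\lambda^{-1/q(\cdot)}f_\nu\big)\le 1\Big\}\in[0,\infty],\qquad \|f\|=\inf\{\mu>0:\ \varrho(f/\mu)\le 1\},$$ where $\lambda^{1/\infty}=1$ and $\inf\emptyset=\infty$. The variable mixed Lebesgue-sequence space $\ell^{q(\cdot)}(L^{p(\cdot)})$ consists of all $f$ (functions being identified when they agree almost everywhere) such that $\varrho(f/\lambda)<\infty$ for some $\lambda>0$. Assume that $\|\cdot\|$ is a norm on $\ell^{q(\cdot)}(L^{p(\cdot)})$, that is, that it satisfies the triangle inequality there. Write $p_-,q_-$ and $p_+,q_+$ for the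 essential infima and essential suprema of $p$ and $q$. If $1<p_-$, $p_+<\infty$, $1<q_-$ and $q_+<\infty$, then $\ell^{q(\cdot)}(L^{p(\cdot)})$ with the norm $\|\cdot\|$ is uniformly convex: for every $\varepsilon\in(0,2]$ there is $\delta>0$ such that $\big\|\tfrac{f+g}{2}\big\|\le 1-\delta$ for all $f,g\in\ell^{q(\cdot)}(L^{p(\cdot)})$ with $\|f\|=\|g\|=1$ and $\|f-g\|\ge\varepsilon$. -/

import Mathlib

open MeasureTheory
open scoped ENNReal

noncomputable section

namespace VarMixed

/-- Sequences `(f_ν)` of (a.e. classes of) measurable functions on `ℝⁿ`. -/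
abbrev FunSeq (𝕜 : Type*) [RCLike 𝕜] (n : ℕ) : Type _ :=
  ℕ → (EuclideanSpace ℝ (Fin n) →ₘ[volume] 𝕜)

/-- The modular of `L^{p(·)}(ℝⁿ)`:
`∫_{p < ∞} |f(x)|^{p(x)} dx + ‖f‖_{L^∞({p = ∞})}`. -/
def lpModular {𝕜 : Type*} [RCLike 𝕜] {n : ℕ} (p : EuclideanSpace ℝ (Fin n) → ℝ≥0∞)
    (f : EuclideanSpace ℝ (Fin n) → 𝕜) : ℝ≥0∞ :=
  (∫⁻ x in {x | p x ≠ ∞}, ‖f x‖ₑ ^ (p x).toReal) +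
    essSup (fun x => ‖f x‖ₑ) (volume.restrict {x | p x = ∞})

/-- `inf {l > 0 : ϱ_{p(·)}(f / l^{1/q(·)}) ≤ 1}`, equal to `∞` if there is no such `l`.
Where `q(x) = ∞` the exponent `1/q(x)` is `0`, so that `l^{1/∞} = 1`. -/
def layerModular {𝕜 : Type*} [RCLike 𝕜] {n : ℕ} (p q : EuclideanSpace ℝ (Fin n) → ℝ≥0∞)
    (f : EuclideanSpace ℝ (Fin n) → 𝕜) : ℝ≥0∞ :=
  ⨅ (l : ℝ) (_ : 0 < l ∧ lpModular p (fun x => (l ^ ((q x).toReal)⁻¹)⁻¹ • f x) ≤ 1),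
    ENNReal.ofReal l

/-- The modular of `ℓ^{q(·)}(L^{p(·)})`. -/
def modular {𝕜 : Type*} [RCLike 𝕜] {n : ℕ} (p q : EuclideanSpace ℝ (Fin n) → ℝ≥0∞)
    (f : FunSeq 𝕜 n) : ℝ≥0∞ :=
  ∑' ν, layerModular p q (f ν)

/-- The Luxemburg functional `inf {μ > 0 : ϱ(f / μ) ≤ 1}` of `ℓ^{q(·)}(L^{p(·)})`, equal to `∞`
if there is no such `μ`. -/
def luxNorm {𝕜 : Type*} [RCLike 𝕜] {n : ℕ} (p q : EuclideanSpace ℝ (Fin n) → ℝ≥0∞)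
    (f : FunSeq 𝕜 n) : ℝ≥0∞ :=
  ⨅ (m : ℝ) (_ : 0 < m ∧ modular p q (((m : 𝕜)⁻¹) • f) ≤ 1), ENNReal.ofReal m

/-- Membership in `ℓ^{q(·)}(L^{p(·)})`: `ϱ(f / l) < ∞` for some `l > 0`. (For exponents bounded
away from `0` this forces every `f_ν` to lie in `L^{p(·)}`.) -/
def MemMixed {𝕜 : Type*} [RCLike 𝕜] {n : ℕ} (p q : EuclideanSpace ℝ (Fin n) → ℝ≥0∞)
    (f : FunSeq 𝕜 n) : Prop :=
  ∃ l : ℝ, 0 < l ∧ modular p q (((l : 𝕜)⁻¹) • f) < ∞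

/-- The triangle inequality for the Luxemburg functional on `ℓ^{q(·)}(L^{p(·)})`, i.e. the
property that makes this quasi-norm a norm. -/
def TriangleIneq (𝕜 : Type*) [RCLike 𝕜] {n : ℕ} (p q : EuclideanSpace ℝ (Fin n) → ℝ≥0∞) : Prop :=
  ∀ f g : FunSeq 𝕜 n, MemMixed p q f → MemMixed p q g →
    luxNorm p q (f + g) ≤ luxNorm p q f + luxNorm p q g

/-- Measurable exponents with values in `[1, ∞]` almost everywhere. -/
structure IsExponent {n : ℕ} (p : EuclideanSpace ℝ (Fin n) → ℝ≥0∞) : Prop where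
  measurable : Measurable p
  one_le : ∀ᵐ x, 1 ≤ p x

section Facts

variable {𝕜 : Type*} [RCLike 𝕜] {n : ℕ} {p q : EuclideanSpace ℝ (Fin n) → ℝ≥0∞}

theorem lpModular_mono {f g : EuclideanSpace ℝ (Fin n) → 𝕜}
    (h : ∀ᵐ x, ‖f x‖ₑ ≤ ‖g x‖ₑ) : lpModular p f ≤ lpModular p g := by
  unfold lpModular
  refine add_le_add ?_ ?_
  · refine lintegral_mono_ae ?_
    filter_upwards [ae_restrict_of_ae h] with x hx
    exact ENNReal.rpow_le_rpow hx ENNReal.toReal_nonneg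
  · exact essSup_mono_ae (ae_restrict_of_ae h)

theorem layerModular_mono {f g : EuclideanSpace ℝ (Fin n) → 𝕜}
    (h : ∀ᵐ x, ‖f x‖ₑ ≤ ‖g x‖ₑ) : layerModular p q f ≤ layerModular p q g := by
  unfold layerModular
  refine le_iInf₂ fun l hl => iInf₂_le_of_le l ⟨hl.1, ?_⟩ le_rfl
  refine (lpModular_mono ?_).trans hl.2
  filter_upwards [h] with x hx
  simp only [enorm_smul]
  gcongr

theorem coeFn_smul_seq (c : 𝕜) (f : FunSeq 𝕜 n) (ν : ℕ) :
    ∀ᵐ x, (c • f) ν x = c * f ν x := by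
  filter_upwards [AEEqFun.coeFn_smul c (f ν)] with x hx
  simpa using hx

theorem modular_smul_mono {a b : 𝕜} (h : ‖a‖ ≤ ‖b‖) (f : FunSeq 𝕜 n) :
    modular p q (a • f) ≤ modular p q (b • f) := by
  refine ENNReal.tsum_le_tsum fun ν => layerModular_mono ?_
  filter_upwards [coeFn_smul_seq a f ν, coeFn_smul_seq b f ν] with x ha hb
  rw [ha, hb, enorm_mul, enorm_mul]
  gcongr
  exact enorm_le_iff_norm_le.2 h

theorem modular_smul_congr {a b : 𝕜} (h : ‖a‖ = ‖b‖) (f : FunSeq 𝕜 n) :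
    modular p q (a • f) = modular p q (b • f) :=
  le_antisymm (modular_smul_mono h.le f) (modular_smul_mono h.ge f)

theorem lpModular_zero (hp : IsExponent p) {f : EuclideanSpace ℝ (Fin n) → 𝕜}
    (hf : ∀ᵐ x, f x = 0) : lpModular p f = 0 := by
  have hS : MeasurableSet {x | p x ≠ ∞} :=
    (hp.measurable (measurableSet_singleton ∞)).compl
  unfold lpModular
  rw [add_eq_zero]
  constructor
  · rw [← lintegral_zero (μ := volume.restrict {x | p x ≠ ∞})]
    refine lintegral_congr_ae ?_
    filter_upwards [ae_restrict_mem hS, ae_restrict_of_ae hp.one_le, ae_restrict_of_ae hf]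
      with x h1 h2 h3
    have h0 : 0 < (p x).toReal := ENNReal.toReal_pos (zero_lt_one.trans_le h2).ne' h1
    simp [h3, h0]
  · rw [essSup_congr_ae (g := fun _ => (0 : ℝ≥0∞))]
    · exact le_antisymm (essSup_le_of_ae_le 0 (Filter.Eventually.of_forall fun _ => le_rfl)) bot_le
    · filter_upwards [ae_restrict_of_ae hf] with x hx
      simp [hx]

theorem layerModular_zero (hp : IsExponent p) {f : EuclideanSpace ℝ (Fin n) → 𝕜}
    (hf : ∀ᵐ x, f x = 0) : layerModular p q f = 0 := by
  refine le_antisymm (ENNReal.le_of_forall_pos_le_add fun ε hε _ => ?_) bot_le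
  refine iInf₂_le_of_le (ε : ℝ) ⟨by exact_mod_cast hε, ?_⟩ (by simp)
  rw [lpModular_zero hp]
  · exact zero_le_one
  · filter_upwards [hf] with x hx
    simp [hx]

theorem modular_zero (hp : IsExponent p) : modular p q (0 : FunSeq 𝕜 n) = 0 := by
  unfold modular
  rw [ENNReal.tsum_eq_zero]
  intro ν
  refine layerModular_zero hp ?_
  exact AEEqFun.coeFn_zero (α := EuclideanSpace ℝ (Fin n)) (β := 𝕜) (μ := volume)

theorem luxNorm_zero (hp : IsExponent p) : luxNorm p q (0 : FunSeq 𝕜 n) = 0 := by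
  refine le_antisymm (ENNReal.le_of_forall_pos_le_add fun ε hε _ => ?_) bot_le
  refine iInf₂_le_of_le (ε : ℝ) ⟨by exact_mod_cast hε, ?_⟩ (by simp)
  have h0 : (((ε : ℝ) : 𝕜)⁻¹ • (0 : FunSeq 𝕜 n)) = 0 := by
    funext ν
    exact smul_zero (A := EuclideanSpace ℝ (Fin n) →ₘ[volume] 𝕜) (((ε : ℝ) : 𝕜)⁻¹)
  rw [h0, modular_zero hp]
  exact zero_le_one

theorem mul_layerModular_le (hq : IsExponent q) {m : ℝ} (hm : 1 ≤ m)
    {f g : EuclideanSpace ℝ (Fin n) → 𝕜} (hg : ∀ᵐ x, g x = (m : 𝕜)⁻¹ * f x) :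
    ENNReal.ofReal m * layerModular p q g ≤ layerModular p q f := by
  have hm0 : 0 < m := by linarith
  conv_rhs => unfold layerModular
  refine le_iInf₂ fun l hl => ?_
  have key : layerModular p q g ≤ ENNReal.ofReal (l / m) := by
    refine iInf₂_le_of_le (l / m) ⟨div_pos hl.1 hm0, ?_⟩ le_rfl
    refine (lpModular_mono ?_).trans hl.2
    filter_upwards [hg, hq.one_le] with x hx hqx
    rw [hx, enorm_le_iff_norm_le, norm_smul, norm_smul, norm_mul, norm_inv, norm_inv, norm_inv,
      RCLike.norm_ofReal, ← mul_assoc]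
    refine mul_le_mul_of_nonneg_right ?_ (norm_nonneg _)
    have hl0 := hl.1
    have e1 : ((q x).toReal)⁻¹ ≤ 1 := by
      by_cases htop : q x = ∞
      · simp [htop]
      · have : 1 ≤ (q x).toReal := by
          simpa using ENNReal.toReal_mono htop hqx
        exact inv_le_one_of_one_le₀ this
    have e2 : m ^ ((q x).toReal)⁻¹ ≤ m := by
      simpa using Real.rpow_le_rpow_of_exponent_le hm e1
    rw [Real.div_rpow hl0.le hm0.le, Real.norm_of_nonneg (by positivity),
      Real.norm_of_nonneg (by positivity), abs_of_pos hm0, inv_div, div_mul_eq_mul_div,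
      ← div_eq_mul_inv, inv_eq_one_div (l ^ _)]
    exact div_le_div_of_nonneg_right ((div_le_one hm0).2 e2) (Real.rpow_nonneg hl0.le _)
  calc ENNReal.ofReal m * layerModular p q g
      ≤ ENNReal.ofReal m * ENNReal.ofReal (l / m) := by gcongr
    _ = ENNReal.ofReal l := by
      rw [← ENNReal.ofReal_mul hm0.le]
      congr 1
      field_simp

theorem mul_modular_le (hq : IsExponent q) {m : ℝ} (hm : 1 ≤ m) (f : FunSeq 𝕜 n) :
    ENNReal.ofReal m * modular p q ((m : 𝕜)⁻¹ • f) ≤ modular p q f := by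
  unfold modular
  rw [← ENNReal.tsum_mul_left]
  exact ENNReal.tsum_le_tsum fun ν => mul_layerModular_le hq hm (coeFn_smul_seq _ f ν)

theorem luxNorm_lt_top_iff (hq : IsExponent q) (f : FunSeq 𝕜 n) :
    luxNorm p q f < ∞ ↔ MemMixed p q f := by
  constructor
  · intro h
    simp only [luxNorm, iInf_lt_iff] at h
    obtain ⟨m, hm, -⟩ := h
    exact ⟨m, hm.1, hm.2.trans_lt ENNReal.one_lt_top⟩
  · rintro ⟨l, hl, hS⟩
    set S := modular p q ((l : 𝕜)⁻¹ • f) with hSdef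
    set m : ℝ := max 1 S.toReal with hmdef
    have hm : 1 ≤ m := le_max_left _ _
    have hm0 : 0 < m := by linarith
    have hSm : S ≤ ENNReal.ofReal m := by
      rw [← ENNReal.ofReal_toReal hS.ne]
      exact ENNReal.ofReal_le_ofReal (le_max_right _ _)
    have h1 := mul_modular_le (p := p) hq hm ((l : 𝕜)⁻¹ • f)
    have h2 : modular p q ((m : 𝕜)⁻¹ • (l : 𝕜)⁻¹ • f) ≤ 1 := by
      have h3 := h1.trans hSm
      have hne : ENNReal.ofReal m ≠ 0 := by simpa using hm0
      by_contra hcon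
      push Not at hcon
      have := ENNReal.mul_lt_mul_right hne ENNReal.ofReal_ne_top hcon
      rw [mul_one] at this
      exact absurd h3 (not_le.2 this)
    refine lt_of_le_of_lt (iInf₂_le_of_le (l * m) ⟨by positivity, ?_⟩ le_rfl) ENNReal.ofReal_lt_top
    rw [smul_smul] at h2
    convert h2 using 3
    push_cast
    rw [mul_inv, mul_comm]

theorem luxNorm_smul_le {c : 𝕜} (hc : c ≠ 0) (f : FunSeq 𝕜 n) :
    luxNorm p q (c • f) ≤ ‖c‖ₑ * luxNorm p q f := by
  have hc0 : 0 < ‖c‖ := norm_pos_iff.2 hc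
  conv_rhs => unfold luxNorm
  rw [ENNReal.mul_iInf_of_ne (by simpa using hc) (by simp)]
  refine le_iInf fun m => ?_
  rw [ENNReal.mul_iInf_of_ne (by simpa using hc) (by simp)]
  refine le_iInf fun hm => ?_
  refine iInf₂_le_of_le (‖c‖ * m) ⟨mul_pos hc0 hm.1, ?_⟩ ?_
  · rw [smul_smul, modular_smul_congr (b := (m : 𝕜)⁻¹)]
    · exact hm.2
    · have := hm.1
      simp only [norm_mul, norm_inv, RCLike.norm_ofReal, abs_mul, abs_norm]
      field_simp
  · rw [ENNReal.ofReal_mul hc0.le, ofReal_norm]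

theorem luxNorm_smul (hp : IsExponent p) (c : 𝕜) (f : FunSeq 𝕜 n) :
    luxNorm p q (c • f) = ‖c‖ₑ * luxNorm p q f := by
  rcases eq_or_ne c 0 with rfl | hc
  · have h0 : ((0 : 𝕜) • f) = 0 := zero_smul 𝕜 f
    rw [h0, luxNorm_zero hp]
    simp
  refine le_antisymm (luxNorm_smul_le hc f) ?_
  have h := luxNorm_smul_le (p := p) (q := q) (inv_ne_zero hc) (c • f)
  rw [inv_smul_smul₀ hc] at h
  calc ‖c‖ₑ * luxNorm p q f ≤ ‖c‖ₑ * (‖c⁻¹‖ₑ * luxNorm p q (c • f)) := by gcongr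
    _ = luxNorm p q (c • f) := by
      rw [← mul_assoc, ← enorm_mul, mul_inv_cancel₀ hc, enorm_one, one_mul]

theorem ae_eq_zero_of_lpModular (hp : IsExponent p) {f : EuclideanSpace ℝ (Fin n) → 𝕜}
    (hf : AEStronglyMeasurable f volume)
    (h : ∀ k : ℕ, 1 ≤ k → lpModular p (fun x => (k : 𝕜) * f x) ≤ 1) : ∀ᵐ x, f x = 0 := by
  have hT : MeasurableSet {x | p x = ∞} := hp.measurable (measurableSet_singleton ∞)
  have hS : MeasurableSet {x | p x ≠ ∞} := hT.compl
  have aux : ∀ a : ℝ≥0∞, (∀ k : ℕ, 1 ≤ k → (k : ℝ≥0∞) * a ≤ 1) → a = 0 := by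
    intro a ha
    by_contra hne
    obtain ⟨k, hk⟩ := ENNReal.exists_nat_mul_gt hne ENNReal.one_ne_top
    rcases Nat.eq_zero_or_pos k with rfl | hk0
    · simp at hk
    · exact absurd (ha k hk0) (not_le.2 hk)
  have h1 : ∫⁻ x in {x | p x ≠ ∞}, ‖f x‖ₑ ^ (p x).toReal = 0 := by
    refine aux _ fun k hk => ?_
    refine le_trans ?_ ((le_add_right le_rfl).trans (h k hk))
    rw [← lintegral_const_mul' _ _ (by simp)]
    refine lintegral_mono_ae ?_
    filter_upwards [ae_restrict_mem hS, ae_restrict_of_ae hp.one_le] with x hx1 hx2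
    have hpx : 1 ≤ (p x).toReal := by simpa using ENNReal.toReal_mono hx1 hx2
    rw [enorm_mul, ENNReal.mul_rpow_of_nonneg _ _ (by linarith)]
    gcongr
    have hkk : ‖(k : 𝕜)‖ₑ = k := by
      rw [← ofReal_norm, RCLike.norm_natCast, ENNReal.ofReal_natCast]
    rw [hkk]
    have hk1 : (1 : ℝ≥0∞) ≤ k := by exact_mod_cast hk
    simpa using ENNReal.rpow_le_rpow_of_exponent_le hk1 hpx
  have h2 : ∀ᵐ x ∂(volume.restrict {x | p x = ∞}), ‖f x‖ₑ = 0 := by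
    have h3 : ∀ k : ℕ, 1 ≤ k → ∀ᵐ x ∂(volume.restrict {x | p x = ∞}),
        (k : ℝ≥0∞) * ‖f x‖ₑ ≤ 1 := by
      intro k hk
      have h4 := (le_add_left le_rfl).trans (h k hk)
      filter_upwards [ae_le_essSup (f := fun x => ‖(k : 𝕜) * f x‖ₑ)
        (μ := volume.restrict {x | p x = ∞})] with x hx
      have hkk : ‖(k : 𝕜)‖ₑ = k := by
        rw [← ofReal_norm, RCLike.norm_natCast, ENNReal.ofReal_natCast]
      rw [enorm_mul, hkk] at hx
      exact hx.trans h4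
    have h5 : ∀ᵐ x ∂(volume.restrict {x | p x = ∞}), ∀ k : ℕ, 1 ≤ k →
        (k : ℝ≥0∞) * ‖f x‖ₑ ≤ 1 := by
      rw [ae_all_iff]
      intro k
      by_cases hk : 1 ≤ k
      · filter_upwards [h3 k hk] with x hx _ using hx
      · exact Filter.Eventually.of_forall fun x hk' => absurd hk' hk
    filter_upwards [h5] with x hx using aux _ hx
  have h6 : ∀ᵐ x ∂(volume.restrict {x | p x ≠ ∞}), ‖f x‖ₑ = 0 := by
    rw [lintegral_eq_zero_iff'] at h1
    · filter_upwards [h1, ae_restrict_mem hS] with x hx hx1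
      rcases ENNReal.rpow_eq_zero_iff.1 hx with h | h
      · exact h.1
      · exact absurd h.2 (not_lt.2 ENNReal.toReal_nonneg)
    · exact (hf.enorm.restrict).pow hp.measurable.ennreal_toReal.aemeasurable
  rw [ae_restrict_iff' hT] at h2
  rw [ae_restrict_iff' hS] at h6
  filter_upwards [h2, h6] with x a b
  by_cases hx : p x = ∞
  · simpa using a hx
  · simpa using b hx

theorem eq_zero_of_luxNorm (hp : IsExponent p) (hq : IsExponent q) {f : FunSeq 𝕜 n}
    (h : luxNorm p q f = 0) : f = 0 := by
  funext ν
  refine AEEqFun.ext ?_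
  have key : ∀ᵐ x, f ν x = 0 := by
    refine ae_eq_zero_of_lpModular hp (f ν).aestronglyMeasurable fun k hk => ?_
    have hk0 : (0 : ℝ) < k := by exact_mod_cast hk
    have hlt : luxNorm p q f < ENNReal.ofReal (1 / (2 * k)) := by
      rw [h]; simpa using hk0
    simp only [luxNorm, iInf_lt_iff] at hlt
    obtain ⟨m, ⟨hm0, hm1⟩, hm2⟩ := hlt
    have hm2' : m < 1 / (2 * k) := (ENNReal.ofReal_lt_ofReal_iff (by positivity)).1 hm2
    have hlay : layerModular p q (((m : 𝕜)⁻¹ • f) ν) < ENNReal.ofReal 2 :=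
      ((ENNReal.le_tsum ν).trans hm1).trans_lt (by norm_num)
    simp only [layerModular, iInf_lt_iff] at hlay
    obtain ⟨l, ⟨hl0, hl1⟩, hl2⟩ := hlay
    have hl2' : l < 2 := (ENNReal.ofReal_lt_ofReal_iff (by norm_num)).1 hl2
    refine (lpModular_mono ?_).trans hl1
    filter_upwards [coeFn_smul_seq (m : 𝕜)⁻¹ f ν, hq.one_le] with x hx hqx
    rw [hx, enorm_le_iff_norm_le, norm_smul, norm_mul, norm_mul, norm_inv, norm_inv,
      RCLike.norm_ofReal, RCLike.norm_natCast, ← mul_assoc, abs_of_pos hm0,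
      Real.norm_of_nonneg (by positivity)]
    refine mul_le_mul_of_nonneg_right ?_ (norm_nonneg _)
    have e1 : ((q x).toReal)⁻¹ ≤ 1 := by
      by_cases htop : q x = ∞
      · simp [htop]
      · have : 1 ≤ (q x).toReal := by
          simpa using ENNReal.toReal_mono htop hqx
        exact inv_le_one_of_one_le₀ this
    have e0 : 0 ≤ ((q x).toReal)⁻¹ := inv_nonneg.2 ENNReal.toReal_nonneg
    have e2 : l ^ ((q x).toReal)⁻¹ ≤ 2 :=
      calc l ^ ((q x).toReal)⁻¹ ≤ (2 : ℝ) ^ ((q x).toReal)⁻¹ :=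
            Real.rpow_le_rpow hl0.le hl2'.le e0
        _ ≤ (2 : ℝ) ^ (1 : ℝ) := Real.rpow_le_rpow_of_exponent_le (by norm_num) e1
        _ = 2 := Real.rpow_one 2
    have e3 : 0 < l ^ ((q x).toReal)⁻¹ := Real.rpow_pos_of_pos hl0 _
    rw [← mul_inv, ← one_div, le_div_iff₀ (by positivity)]
    rw [lt_div_iff₀ (by positivity)] at hm2'
    calc (k : ℝ) * (l ^ ((q x).toReal)⁻¹ * m) ≤ k * (2 * m) := by gcongr
      _ ≤ 1 := by linarith
  filter_upwards [key, AEEqFun.coeFn_zero (α := EuclideanSpace ℝ (Fin n)) (β := 𝕜) (μ := volume)]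
    with x hx h0
  rw [hx]
  exact h0.symm

end Facts

/-- The space `ℓ^{q(·)}(L^{p(·)})` of all sequences `f` with `ϱ(f / l) < ∞` for some `l > 0`, for
exponents `p, q` for which its Luxemburg functional satisfies the triangle inequality. -/
def MixedSpace (𝕜 : Type*) [RCLike 𝕜] {n : ℕ} {p q : EuclideanSpace ℝ (Fin n) → ℝ≥0∞}
    (hp : IsExponent p) (hq : IsExponent q) (htri : TriangleIneq 𝕜 p q) :
    Submodule 𝕜 (FunSeq 𝕜 n) where
  carrier := {f | MemMixed p q f}
  zero_mem' := (luxNorm_lt_top_iff hq _).1 (by rw [luxNorm_zero hp]; exact ENNReal.zero_lt_top)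
  add_mem' := fun {f g} hf hg => (luxNorm_lt_top_iff hq _).1 <|
    (htri f g hf hg).trans_lt <| ENNReal.add_lt_top.2
      ⟨(luxNorm_lt_top_iff hq _).2 hf, (luxNorm_lt_top_iff hq _).2 hg⟩
  smul_mem' := fun c f hf => (luxNorm_lt_top_iff hq _).1 <| by
    rw [luxNorm_smul hp]
    exact ENNReal.mul_lt_top (by simp) ((luxNorm_lt_top_iff hq _).2 hf)

section Instances

variable {𝕜 : Type*} [RCLike 𝕜] {n : ℕ} {p q : EuclideanSpace ℝ (Fin n) → ℝ≥0∞}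
  {hp : IsExponent p} {hq : IsExponent q} {htri : TriangleIneq 𝕜 p q}

instance : Norm (MixedSpace 𝕜 hp hq htri) where
  norm f := (luxNorm p q (f : FunSeq 𝕜 n)).toReal

theorem MixedSpace.norm_def (f : MixedSpace 𝕜 hp hq htri) :
    ‖f‖ = (luxNorm p q (f : FunSeq 𝕜 n)).toReal := rfl

theorem luxNorm_ne_top (f : MixedSpace 𝕜 hp hq htri) :
    luxNorm p q (f : FunSeq 𝕜 n) ≠ ∞ :=
  ((luxNorm_lt_top_iff hq _).2 f.2).ne

theorem MixedSpace.core : NormedSpace.Core 𝕜 (MixedSpace 𝕜 hp hq htri) where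
  norm_nonneg _ := ENNReal.toReal_nonneg
  norm_smul c f := by
    rw [norm_def, norm_def, Submodule.coe_smul, luxNorm_smul hp, ENNReal.toReal_mul, toReal_enorm]
  norm_triangle f g := by
    rw [norm_def, norm_def, norm_def, Submodule.coe_add,
      ← ENNReal.toReal_add (luxNorm_ne_top f) (luxNorm_ne_top g)]
    exact ENNReal.toReal_mono (ENNReal.add_ne_top.2 ⟨(luxNorm_ne_top f), (luxNorm_ne_top g)⟩)
      (htri _ _ f.2 g.2)
  norm_eq_zero_iff f := by
    rw [norm_def, ENNReal.toReal_eq_zero_iff, or_iff_left (luxNorm_ne_top f)]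
    constructor
    · intro h
      exact Subtype.ext (eq_zero_of_luxNorm hp hq h)
    · rintro rfl
      exact luxNorm_zero hp

instance : NormedAddCommGroup (MixedSpace 𝕜 hp hq htri) :=
  NormedAddCommGroup.ofCore MixedSpace.core

instance : NormedSpace 𝕜 (MixedSpace 𝕜 hp hq htri) :=
  NormedSpace.ofCore MixedSpace.core

end Instances

end VarMixed

end

/-! Put a = 1/q. A layer u ≥ 0 is measured by the least level l with ∫ (l^(-a) u)^P ≤ 1, and the
modular ϱ adds these levels over ν. Since a is bounded below, dilating f changes ϱ(f) by at most a
fixed power of the factor, so uniform convexity of the norm follows from a modular form of it: for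
each ε there is δ with ϱ((f+g)/2) + δ ϱ(f-g) ≤ (1/2 + δε)(ϱ(f) + ϱ(g)). This inequality is additive
in ν, so it is enough to prove it for a single layer (`ConvexLayer.exists_adm_uniformConvex`).

The triangle inequality enters only through `ExponentBounds.convexLayer`: applied to the two-term
sequences (F, G) and (G, F), it makes the level of one layer midpoint convex.

Let s, t be levels of f, g. If they are nearly equal, both functions can be measured at the level
max s t, and the uniform convexity of |z|^p, uniform for p in [p₀, p₁], gives the gain. If they are
far apart, the gain must come from the levels alone. Midpoint convexity yields a first-order
inequality (`ConvexLayer.integral_first_order_nonpos`), and a Lagrange multiplier argument turns it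
into the pointwise inequality `slack ≥ 0`, with one multiplier M = l^m for almost all x
(`ConvexLayer.exists_multiplier`).

If the midpoint gained almost nothing, the slack would have almost zero mean, both at the midpoint
and half-way from there to the end with the larger level, while the first-order term would also have
almost zero mean. But when both slacks vanish at a point and the exponents satisfy m' ≤ m, then m is
0 or 1 and the first-order term has a strict sign (`sign_of_slack_eq_zero`). Compactness makes this
uniform (`exists_uniform_slack`), and integration gives a contradiction. -/

namespace VarMixed

/-! ### Bernoulli-type inequalities -/

theorem bernoulli_rpow {x c : ℝ} (hx : 0 ≤ x) (hc : 1 ≤ c) : 1 + c * (x - 1) ≤ x ^ c := by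
  have := one_add_mul_self_le_rpow_one_add (s := x - 1) (by linarith) hc
  rwa [add_sub_cancel] at this

theorem bernoulli_rpow_concave {x c : ℝ} (hx : 0 ≤ x) (hc0 : 0 ≤ c) (hc : c ≤ 1) :
    x ^ c ≤ 1 + c * (x - 1) := by
  have := rpow_one_add_le_one_add_mul_self (s := x - 1) (by linarith) hc0 hc
  rwa [add_sub_cancel] at this

theorem bernoulli_rpow_strict {x c : ℝ} (hx : 0 ≤ x) (hx1 : x ≠ 1) (hc : 1 < c) :
    1 + c * (x - 1) < x ^ c := by
  have := one_add_mul_self_lt_rpow_one_add (s := x - 1) (by linarith) (sub_ne_zero.2 hx1) hc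
  rwa [add_sub_cancel] at this

theorem bernoulli_rpow_concave_strict {x c : ℝ} (hx : 0 ≤ x) (hx1 : x ≠ 1) (hc0 : 0 < c)
    (hc : c < 1) : x ^ c < 1 + c * (x - 1) := by
  have := rpow_one_add_lt_one_add_mul_self (s := x - 1) (by linarith) (sub_ne_zero.2 hx1) hc0 hc
  rwa [add_sub_cancel] at this

/-- A negative exponent reduces to the exponent 1 - c > 1 at the point x⁻¹, after multiplication by
x. -/
theorem bernoulli_rpow_strict_of_not_mem {x c : ℝ} (hx : 0 < x) (hx1 : x ≠ 1)
    (hc : c < 0 ∨ 1 < c) : 1 + c * (x - 1) < x ^ c := by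
  rcases hc with hc | hc
  · have h := bernoulli_rpow_strict (x := x⁻¹) (c := 1 - c) (by positivity)
      (by simpa using hx1) (by linarith)
    have h2 : x * (x⁻¹) ^ (1 - c) = x ^ c := by
      rw [Real.inv_rpow hx.le, ← Real.rpow_neg hx.le, ← Real.rpow_one_add' hx.le (by linarith)]
      congr 1; ring
    have h3 := mul_lt_mul_of_pos_left h hx
    rw [h2] at h3
    have h4 : x * (1 + (1 - c) * (x⁻¹ - 1)) = 1 + c * (x - 1) := by field_simp; ring
    linarith
  · exact bernoulli_rpow_strict hx.le hx1 hc

theorem bernoulli_rpow_weak_of_not_mem {x c : ℝ} (hx : 0 < x)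
    (hc : c < 0 ∨ 1 < c) : 1 + c * (x - 1) ≤ x ^ c := by
  rcases eq_or_ne x 1 with rfl | h
  · simp
  · exact (bernoulli_rpow_strict_of_not_mem hx h hc).le

/-! ### The pointwise slack in the supporting hyperplane inequality -/

/-- The slack at `r` of the supporting hyperplane, with multiplier `M`, to the level set
`(l ^ (-a) * r) ^ p = 1` at the point `(r, l) = (1, 1)`. -/
noncomputable def slack (p a M l r : ℝ) : ℝ := M * ((l ^ (-a) * r) ^ p - 1) - p * (r - 1 - a * (l - 1))

/-- The exponent `e` for which `r = l ^ e` minimizes `slack p a (l ^ m) l r`. -/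
noncomputable def dualExp (p a m : ℝ) : ℝ := (p * a - m) / (p - 1)

/-- The minimal value over `r` of `slack p a (l ^ m) l r`. -/
noncomputable def gap (p a m l : ℝ) : ℝ := p * (1 - a + a * l) - l ^ m - (p - 1) * l ^ dualExp p a m

theorem dualExp_mul {p a m : ℝ} (hp : 1 < p) : (p - 1) * dualExp p a m = p * a - m := by
  unfold dualExp
  field_simp [(sub_pos.2 hp).ne']

/-- For fixed l the slack is convex in r with minimizer l^e. Rescaling r by the minimizer splits the
slack into a Bernoulli defect, which vanishes only at r = l^e, and the minimal value `gap`. -/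
theorem slack_eq {p a m l r : ℝ} (hp : 1 < p) (hl : 0 < l) (hr : 0 ≤ r) :
    slack p a (l ^ m) l r = l ^ dualExp p a m * ((r / l ^ dualExp p a m) ^ p - 1 -
      p * (r / l ^ dualExp p a m - 1)) + gap p a m l := by
  set e := dualExp p a m with he
  have hE : 0 < l ^ e := Real.rpow_pos_of_pos hl _
  have h1 := dualExp_mul (a := a) (m := m) hp
  rw [← he] at h1
  have h2 : l ^ m * (l ^ (-a) * r) ^ p = l ^ e * (r / l ^ e) ^ p := by
    rw [Real.mul_rpow (by positivity) hr, Real.div_rpow hr hE.le, ← Real.rpow_mul hl.le,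
      ← Real.rpow_mul hl.le, mul_div_assoc', mul_comm (l ^ e), mul_div_assoc,
      ← Real.rpow_sub hl, ← mul_assoc, ← Real.rpow_add hl, mul_comm]
    congr 2; linarith
  unfold slack gap
  rw [mul_sub, h2, ← he]
  field_simp
  ring

theorem gap_eq_slack {p a m l : ℝ} (hp : 1 < p) (hl : 0 < l) :
    slack p a (l ^ m) l (l ^ dualExp p a m) = gap p a m l := by
  have hE : 0 < l ^ dualExp p a m := Real.rpow_pos_of_pos hl _
  rw [slack_eq hp hl hE.le, div_self hE.ne']
  simp

theorem slack_nonneg_of_gap {p a m l r : ℝ} (hp : 1 < p) (hl : 0 < l) (hr : 0 ≤ r)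
    (h : 0 ≤ gap p a m l) : 0 ≤ slack p a (l ^ m) l r := by
  have hE : 0 < l ^ dualExp p a m := Real.rpow_pos_of_pos hl _
  rw [slack_eq hp hl hr]
  have := bernoulli_rpow (x := r / l ^ dualExp p a m) (by positivity) hp.le
  have h2 := mul_nonneg hE.le (by linarith : 0 ≤ (r / l ^ dualExp p a m) ^ p - 1 -
      p * (r / l ^ dualExp p a m - 1))
  linarith

theorem eq_of_slack_eq_zero {p a m l r : ℝ} (hp : 1 < p) (hl : 0 < l) (hr : 0 ≤ r)
    (h : 0 ≤ gap p a m l) (h0 : slack p a (l ^ m) l r = 0) :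
    r = l ^ dualExp p a m ∧ gap p a m l = 0 := by
  have hE : 0 < l ^ dualExp p a m := Real.rpow_pos_of_pos hl _
  rw [slack_eq hp hl hr] at h0
  by_cases h1 : r / l ^ dualExp p a m = 1
  · rw [h1] at h0
    refine ⟨by field_simp at h1; exact h1, by simpa using h0⟩
  · exfalso
    have := bernoulli_rpow_strict (x := r / l ^ dualExp p a m) (by positivity) h1 hp
    have h2 := mul_pos hE (by linarith : 0 < (r / l ^ dualExp p a m) ^ p - 1 -
      p * (r / l ^ dualExp p a m - 1))
    linarith

/-- Every point has its own multiplier l^a: use the convex Bernoulli inequality for l^(-a) r and the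
concave one for l^a. What this does not give is a multiplier common to all points. -/
theorem slack_rpow_self_nonneg {p a l r : ℝ} (hp : 1 ≤ p) (ha0 : 0 ≤ a) (ha1 : a ≤ 1) (hl : 0 < l)
    (hr : 0 ≤ r) : 0 ≤ slack p a (l ^ a) l r := by
  have h1 := bernoulli_rpow (x := l ^ (-a) * r) (by positivity) hp
  have h2 := bernoulli_rpow_concave hl.le ha0 ha1
  have hA : 0 < l ^ a := Real.rpow_pos_of_pos hl _
  have h3 : l ^ a * (l ^ (-a) * r) = r := by
    rw [← mul_assoc, ← Real.rpow_add hl]; simp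
  have h4 := mul_le_mul_of_nonneg_left h1 hA.le
  have h5 : l ^ a * (1 + p * (l ^ (-a) * r - 1)) = l ^ a + p * (r - l ^ a) := by
    linear_combination p * h3
  unfold slack
  have h6 := mul_le_mul_of_nonneg_left h2 (by linarith : 0 ≤ p)
  linarith

/-- The slack is affine in the multiplier. -/
theorem slack_nonneg_of_mem_segment {p a M₁ M M₂ l r : ℝ} (h₁ : M₁ ≤ M) (h₂ : M ≤ M₂)
    (hs₁ : 0 ≤ slack p a M₁ l r) (hs₂ : 0 ≤ slack p a M₂ l r) : 0 ≤ slack p a M l r := by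
  unfold slack at *
  rcases le_total 0 ((l ^ (-a) * r) ^ p - 1) with h | h
  · have := mul_le_mul_of_nonneg_right h₁ h
    linarith
  · have := mul_le_mul_of_nonpos_right h₂ h
    linarith

theorem gap_one {p a m : ℝ} : gap p a m 1 = 0 := by
  simp [gap]

/-- The gap vanishes to first order at 1. If e ≤ 1 it is nonnegative by the concave Bernoulli
inequality. If e > 1 its second derivative is a positive power times a decreasing function, so it
can change sign only from plus to minus; a gap that is negative at l' and nonnegative again at l
would need the opposite change. -/
theorem gap_nonneg_of_lt {p a m l l' : ℝ} (hp : 1 < p) (hm : 0 ≤ m) (hma : m < a)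
    (ha1 : a < 1) (hl' : 1 < l') (hl : l' < l) (h : 0 ≤ gap p a m l) : 0 ≤ gap p a m l' := by
  set e := dualExp p a m with he
  have h1 := dualExp_mul (a := a) (m := m) hp
  rw [← he] at h1
  have hp1 : 0 < p - 1 := by linarith
  have hea : a < e := by
    by_contra hcon
    push Not at hcon
    nlinarith
  rcases le_or_gt e 1 with he1 | he1
  · have b1 := bernoulli_rpow_concave (x := l') (by linarith) hm (by linarith)
    have b2 := bernoulli_rpow_concave (x := l') (by linarith) (by linarith) he1
    have b3 := mul_le_mul_of_nonneg_left b2 hp1.le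
    have b4 : (p - 1) * (1 + e * (l' - 1)) = (p - 1) + (p * a - m) * (l' - 1) := by
      rw [← h1]; ring
    unfold gap
    rw [← he]
    linarith
  by_contra hneg
  push Not at hneg
  set G' : ℝ → ℝ := fun t => p * a - m * t ^ (m - 1) - (p - 1) * (e * t ^ (e - 1)) with hG'
  set G'' : ℝ → ℝ := fun t => - (m * ((m - 1) * t ^ (m - 1 - 1))) -
    (p - 1) * (e * ((e - 1) * t ^ (e - 1 - 1))) with hG''
  have d1 : ∀ t : ℝ, 0 < t → HasDerivAt (gap p a m) (G' t) t := by
    intro t ht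
    have a1 := Real.hasDerivAt_rpow_const (x := t) (p := m) (Or.inl ht.ne')
    have a2 := Real.hasDerivAt_rpow_const (x := t) (p := e) (Or.inl ht.ne')
    have a3 := ((((hasDerivAt_id t).const_mul a).const_add (1 - a)).const_mul p)
    have a4 := (a3.sub a1).sub (a2.const_mul (p - 1))
    refine a4.congr_deriv ?_
    show p * (a * 1) - m * t ^ (m - 1) - (p - 1) * (e * t ^ (e - 1)) = _
    rw [mul_one]
  have d2 : ∀ t : ℝ, 0 < t → HasDerivAt G' (G'' t) t := by
    intro t ht
    have a1 := Real.hasDerivAt_rpow_const (x := t) (p := m - 1) (Or.inl ht.ne')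
    have a2 := Real.hasDerivAt_rpow_const (x := t) (p := e - 1) (Or.inl ht.ne')
    have a4 := ((a1.const_mul m).const_sub (p * a)).sub ((a2.const_mul e).const_mul (p - 1))
    exact a4
  have c1 : ∀ u v : ℝ, 1 ≤ u → ContinuousOn (gap p a m) (Set.Icc u v) := fun u v hu x hx =>
    (d1 x (by linarith [hx.1])).continuousAt.continuousWithinAt
  have c2 : ∀ u v : ℝ, 1 ≤ u → ContinuousOn G' (Set.Icc u v) := fun u v hu x hx =>
    (d2 x (by linarith [hx.1])).continuousAt.continuousWithinAt
  -- Two rounds of the mean value theorem: the first derivative is zero at 1, negative at x1 and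
  -- positive at x2, hence the second derivative is negative at y1 and positive at the later point
  -- y2.
  obtain ⟨x1, hx1, e1⟩ := exists_hasDerivAt_eq_slope _ _ hl' (c1 1 l' le_rfl)
    (fun x hx => d1 x (by linarith [hx.1]))
  obtain ⟨x2, hx2, e2⟩ := exists_hasDerivAt_eq_slope _ _ hl (c1 l' l hl'.le)
    (fun x hx => d1 x (by linarith [hx.1]))
  rw [gap_one, sub_zero] at e1
  have n1 : G' x1 < 0 := by rw [e1]; exact div_neg_of_neg_of_pos hneg (by linarith)
  have n2 : 0 < G' x2 := by rw [e2]; exact div_pos (by linarith) (by linarith)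
  have n0 : G' 1 = 0 := by
    simp only [hG', Real.one_rpow]
    linarith
  obtain ⟨y1, hy1, f1⟩ := exists_hasDerivAt_eq_slope _ _ hx1.1 (c2 1 x1 le_rfl)
    (fun x hx => d2 x (by linarith [hx.1]))
  obtain ⟨y2, hy2, f2⟩ := exists_hasDerivAt_eq_slope _ _ (hx1.2.trans hx2.1) (c2 x1 x2 hx1.1.le)
    (fun x hx => d2 x (by linarith [hx.1, hx1.1]))
  rw [n0, sub_zero] at f1
  have k1 : G'' y1 < 0 := by rw [f1]; exact div_neg_of_neg_of_pos n1 (by linarith [hx1.1])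
  have k2 : 0 < G'' y2 := by rw [f2]; exact div_pos (by linarith) (by linarith [hx1.2, hx2.1])
  have key : ∀ t : ℝ, 0 < t → G'' t = t ^ (m - 1 - 1) *
      (m * (1 - m) - (p - 1) * (e * (e - 1)) * t ^ (e - m)) := by
    intro t ht
    have : t ^ (e - 1 - 1) = t ^ (m - 1 - 1) * t ^ (e - m) := by
      rw [← Real.rpow_add ht]; congr 1; ring
    simp only [hG'', this]
    ring
  have y1pos : 0 < y1 := by linarith [hy1.1]
  have y2pos : 0 < y2 := by linarith [hy2.1, hx1.1]
  rw [key y1 y1pos] at k1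
  rw [key y2 y2pos] at k2
  have k1' := neg_of_mul_neg_right k1 (Real.rpow_nonneg y1pos.le _)
  have k2' := pos_of_mul_pos_right k2 (Real.rpow_nonneg y2pos.le _)
  have mono : y1 ^ (e - m) ≤ y2 ^ (e - m) :=
    Real.rpow_le_rpow y1pos.le (by linarith [hy1.2, hy2.1]) (by linarith)
  have : (p - 1) * (e * (e - 1)) * y1 ^ (e - m) ≤ (p - 1) * (e * (e - 1)) * y2 ^ (e - m) :=
    mul_le_mul_of_nonneg_left mono
      (mul_nonneg hp1.le (mul_nonneg (by linarith) (by linarith)))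
  linarith

/-- For a pair of collinear supporting inequalities, with the base point of the second half-way
between the base point and the end point of the first, equality in both can only occur in the
degenerate cases `m = 0` and `m = 1`, in which the increment has a strict sign. -/
theorem sign_of_slack_eq_zero {p a m m' l r : ℝ} (hp : 1 < p) (ha0 : 0 < a) (ha1 : a < 1)
    (hm0 : 0 ≤ m) (hm1 : m ≤ 1) (hm' : m' ≤ m) (hl : 1 < l) (hr : 0 ≤ r)
    (h : 0 ≤ gap p a m l) (h' : 0 ≤ gap p a m' (2 * l / (1 + l)))
    (hs : slack p a (l ^ m) l r = 0)
    (hs' : slack p a ((2 * l / (1 + l)) ^ m') (2 * l / (1 + l)) (2 * r / (1 + r)) = 0) :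
    0 < (1 - 2 * m) * (p * (r - 1 - a * (l - 1))) := by
  have hl0 : 0 < l := by linarith
  set l' := 2 * l / (1 + l) with hl'
  have hl'1 : 1 < l' := by rw [hl', lt_div_iff₀ (by linarith)]; linarith
  obtain ⟨hr1, hg⟩ := eq_of_slack_eq_zero hp hl0 hr h hs
  obtain ⟨hr2, -⟩ := eq_of_slack_eq_zero hp (by linarith) (by positivity) h' hs'
  set e := dualExp p a m with he
  have h1 := dualExp_mul (a := a) (m := m) hp
  rw [← he] at h1
  have hp1 : 0 < p - 1 := by linarith
  have hee' : e ≤ dualExp p a m' := by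
    rw [he]; unfold dualExp; gcongr
  have hr0 : 0 < r := by rw [hr1]; positivity
  have hrge : l' ^ e ≤ 2 * r / (1 + r) := by
    rw [hr2]; exact Real.rpow_le_rpow_of_exponent_le hl'1.le hee'
  -- Outside [0, 1] the Bernoulli inequality at l' and at l' / l, two numbers with sum 2, gives l'^e
  -- (1 + 1/r) > 2. This contradicts `hrge`.
  have hmem : ¬ (e < 0 ∨ 1 < e) := by
    intro hout
    have b1 := bernoulli_rpow_strict_of_not_mem (x := l') (by linarith) hl'1.ne' hout
    have b2 := bernoulli_rpow_weak_of_not_mem (x := l' / l) (by positivity) hout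
    rw [Real.div_rpow (by linarith) hl0.le, ← hr1] at b2
    have b3 : l' + l' / l = 2 := by rw [hl']; field_simp; ring
    have b4 : 2 < l' ^ e * (1 + r) / r := by
      have : l' ^ e * (1 + r) / r = l' ^ e + l' ^ e / r := by field_simp; ring
      rw [this]
      have b5 : e * l' + e * (l' / l) = e * 2 := by rw [← b3]; ring
      linarith
    rw [le_div_iff₀ (by linarith)] at hrge
    rw [lt_div_iff₀ hr0] at b4
    linarith
  push Not at hmem
  obtain ⟨he0, he1⟩ := hmem
  have q1 := bernoulli_rpow_concave hl0.le hm0 hm1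
  have q2 := mul_le_mul_of_nonneg_left (bernoulli_rpow_concave hl0.le he0 he1) hp1.le
  have q3 : (p - 1) * (1 + e * (l - 1)) = (p - 1) + (p * a - m) * (l - 1) := by
    rw [← h1]; ring
  unfold gap at hg
  rw [← he] at hg
  -- A vanishing gap forces equality in both concave Bernoulli inequalities, for l^m and for l^e; as
  -- l ≠ 1, both exponents are endpoints of [0, 1].
  have m01 : m = 0 ∨ m = 1 := by
    by_contra hcon
    push Not at hcon
    have := bernoulli_rpow_concave_strict hl0.le hl.ne' (lt_of_le_of_ne hm0 hcon.1.symm)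
      (lt_of_le_of_ne hm1 hcon.2)
    linarith
  have e01 : e = 0 ∨ e = 1 := by
    by_contra hcon
    push Not at hcon
    have := mul_lt_mul_of_pos_left (bernoulli_rpow_concave_strict hl0.le hl.ne'
      (lt_of_le_of_ne he0 hcon.1.symm) (lt_of_le_of_ne he1 hcon.2)) hp1
    linarith
  -- The relation (p - 1) e = p a - m excludes m = e, because 0 < a < 1. The surviving cases are r =
  -- l with m = 0, and r = 1 with m = 1.
  rcases m01 with hm | hm <;> rcases e01 with hee | hee
  · rw [hm, hee] at h1
    nlinarith
  · rw [hee, Real.rpow_one] at hr1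
    rw [hm, hr1]
    have : 0 < p * ((1 - a) * (l - 1)) :=
      mul_pos (by linarith) (mul_pos (by linarith) (by linarith))
    linarith
  · rw [hee, Real.rpow_zero] at hr1
    rw [hm, hr1]
    have : 0 < p * (a * (l - 1)) :=
      mul_pos (by linarith) (mul_pos (by linarith) (by linarith))
    linarith
  · rw [hm, hee] at h1
    nlinarith

end VarMixed

/-! ### Compactness: a uniform version of the equality analysis -/

namespace VarMixed

/-- Because S ≥ 0, the open sets where N S + Z > 0 increase with N, and they cover K since Z > 0
wherever S = 0. One of them contains K, and continuity gives a positive minimum there. -/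
theorem _root_.IsCompact.exists_mul_add_ge {X : Type*} [TopologicalSpace X] {K : Set X}
    (hK : IsCompact K) {S Z : X → ℝ} (hS : ContinuousOn S K) (hZ : ContinuousOn Z K)
    (hS0 : ∀ x ∈ K, 0 ≤ S x) (hpos : ∀ x ∈ K, S x = 0 → 0 < Z x) :
    ∃ N c : ℝ, 0 ≤ N ∧ 0 < c ∧ ∀ x ∈ K, c ≤ N * S x + Z x := by
  rcases K.eq_empty_or_nonempty with rfl | hne
  · exact ⟨0, 1, le_rfl, one_pos, by simp⟩
  have hKc : CompactSpace K := isCompact_iff_compactSpace.1 hK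
  have hS' : Continuous (fun x : K => S x) := continuousOn_iff_continuous_domRestrict.1 hS
  have hZ' : Continuous (fun x : K => Z x) := continuousOn_iff_continuous_domRestrict.1 hZ
  obtain ⟨N, hN⟩ := isCompact_univ.elim_directed_cover
    (fun k : ℕ => {x : K | 0 < (k : ℝ) * S x + Z x})
    (fun k => isOpen_lt continuous_const ((hS'.const_mul _).add hZ'))
    (by
      rintro x -
      rw [Set.mem_iUnion]
      rcases eq_or_lt_of_le (hS0 x x.2) with h | h
      · exact ⟨0, by simpa using hpos x x.2 h.symm⟩
      · obtain ⟨k, hk⟩ := exists_nat_gt (-Z x / S x)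
        refine ⟨k, ?_⟩
        rw [div_lt_iff₀ h] at hk
        show 0 < (k : ℝ) * S x + Z x
        linarith)
    (directed_of_isDirected_le (fun i j hij x hx => by
      have h1 : (i : ℝ) ≤ j := by exact_mod_cast hij
      have h2 := mul_le_mul_of_nonneg_right h1 (hS0 x x.2)
      have h3 : 0 < (i : ℝ) * S x + Z x := hx
      show 0 < (j : ℝ) * S x + Z x
      linarith))
  obtain ⟨x0, hx0, hmin⟩ := hK.exists_isMinOn hne ((hS.const_mul (N : ℝ)).add hZ)
  exact ⟨N, N * S x0 + Z x0, N.cast_nonneg, hN (Set.mem_univ ⟨x0, hx0⟩), fun x hx => hmin hx⟩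

theorem continuousOn_gap {X : Type*} [TopologicalSpace X] {K : Set X} {p a m l : X → ℝ}
    (hp : ContinuousOn p K) (ha : ContinuousOn a K) (hm : ContinuousOn m K)
    (hl : ContinuousOn l K) (hp1 : ∀ x ∈ K, 1 < p x) (hl0 : ∀ x ∈ K, 0 < l x) :
    ContinuousOn (fun x => gap (p x) (a x) (m x) (l x)) K := by
  unfold gap dualExp
  have he : ContinuousOn (fun x => (p x * a x - m x) / (p x - 1)) K :=
    ((hp.mul ha).sub hm).div (hp.sub continuousOn_const) fun x hx => by
      have := hp1 x hx; intro h; linarith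
  exact ((hp.mul ((continuousOn_const.sub ha).add (ha.mul hl))).sub
    (hl.rpow hm fun x hx => Or.inl (hl0 x hx).ne')).sub
    ((hp.sub continuousOn_const).mul (hl.rpow he fun x hx => Or.inl (hl0 x hx).ne'))

theorem continuousOn_slack {X : Type*} [TopologicalSpace X] {K : Set X} {p a M l r : X → ℝ}
    (hp : ContinuousOn p K) (ha : ContinuousOn a K) (hM : ContinuousOn M K)
    (hl : ContinuousOn l K) (hr : ContinuousOn r K) (hp1 : ∀ x ∈ K, 1 < p x)
    (hl0 : ∀ x ∈ K, 0 < l x) :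
    ContinuousOn (fun x => slack (p x) (a x) (M x) (l x) (r x)) K := by
  unfold slack
  refine (hM.mul (((((hl.rpow ha.neg fun x hx => Or.inl (hl0 x hx).ne')).mul hr).rpow hp
    fun x hx => Or.inr (by linarith [hp1 x hx])).sub continuousOn_const)).sub
    (hp.mul ((hr.sub continuousOn_const).sub (ha.mul (hl.sub continuousOn_const))))

/-- The admissible parameters form a compact set, on which the sum of the two slacks is nonnegative
and, by `sign_of_slack_eq_zero`, the signed increment is positive wherever that sum vanishes. The
bound 1 + η ≤ l keeps the set away from the trivial equality at l = 1. -/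
theorem exists_uniform_slack {p₀ p₁ a₀ a₁ η : ℝ} (hp₀ : 1 < p₀) (ha₀ : 0 < a₀) (ha₁ : a₁ < 1)
    (hη : 0 < η) : ∃ N c : ℝ, 0 ≤ N ∧ 0 < c ∧ ∀ p a m m' l r : ℝ, p ∈ Set.Icc p₀ p₁ →
      a ∈ Set.Icc a₀ a₁ → 0 ≤ m' → m' ≤ m → m ≤ 1 → 1 + η ≤ l → l ≤ 2 → 0 ≤ r → r ≤ 2 →
      0 ≤ gap p a m l → 0 ≤ gap p a m' (2 * l / (1 + l)) →
      c ≤ N * (slack p a (l ^ m) l r +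
        slack p a ((2 * l / (1 + l)) ^ m') (2 * l / (1 + l)) (2 * r / (1 + r))) +
        (1 - 2 * m) * (p * (r - 1 - a * (l - 1))) := by
  set B : Set (ℝ × ℝ × ℝ × ℝ × ℝ × ℝ) := Set.Icc p₀ p₁ ×ˢ Set.Icc a₀ a₁ ×ˢ Set.Icc 0 1 ×ˢ
    Set.Icc 0 1 ×ˢ Set.Icc (1 + η) 2 ×ˢ Set.Icc 0 2 with hB
  have hBc : IsCompact B := isCompact_Icc.prod (isCompact_Icc.prod (isCompact_Icc.prod
    (isCompact_Icc.prod (isCompact_Icc.prod isCompact_Icc))))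
  let p : ℝ × ℝ × ℝ × ℝ × ℝ × ℝ → ℝ := fun z => z.1
  let a : ℝ × ℝ × ℝ × ℝ × ℝ × ℝ → ℝ := fun z => z.2.1
  let m : ℝ × ℝ × ℝ × ℝ × ℝ × ℝ → ℝ := fun z => z.2.2.1
  let m' : ℝ × ℝ × ℝ × ℝ × ℝ × ℝ → ℝ := fun z => z.2.2.2.1
  let l : ℝ × ℝ × ℝ × ℝ × ℝ × ℝ → ℝ := fun z => z.2.2.2.2.1
  let r : ℝ × ℝ × ℝ × ℝ × ℝ × ℝ → ℝ := fun z => z.2.2.2.2.2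
  let l' : ℝ × ℝ × ℝ × ℝ × ℝ × ℝ → ℝ := fun z => 2 * l z / (1 + l z)
  let r' : ℝ × ℝ × ℝ × ℝ × ℝ × ℝ → ℝ := fun z => 2 * r z / (1 + r z)
  have hp : Continuous p := by fun_prop
  have ha : Continuous a := by fun_prop
  have hm : Continuous m := by fun_prop
  have hm' : Continuous m' := by fun_prop
  have hl : Continuous l := by fun_prop
  have hr : Continuous r := by fun_prop
  have bp : ∀ z ∈ B, 1 < p z := fun z hz => lt_of_lt_of_le hp₀ hz.1.1
  have bl : ∀ z ∈ B, 1 < l z := fun z hz => by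
    have : 1 + η ≤ l z := hz.2.2.2.2.1.1
    linarith
  have bl0 : ∀ z ∈ B, 0 < l z := fun z hz => by linarith [bl z hz]
  have br : ∀ z ∈ B, 0 ≤ r z := fun z hz => hz.2.2.2.2.2.1
  have bl'0 : ∀ z ∈ B, 0 < l' z := fun z hz => by
    have := bl0 z hz
    show 0 < 2 * l z / (1 + l z)
    positivity
  have hl' : ContinuousOn l' B := (hl.const_mul 2).continuousOn.div
    (continuous_const.add hl).continuousOn fun z hz => by have := bl0 z hz; positivity
  have hr' : ContinuousOn r' B := (hr.const_mul 2).continuousOn.div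
    (continuous_const.add hr).continuousOn fun z hz => by have := br z hz; positivity
  have g1 := continuousOn_gap (K := B) hp.continuousOn ha.continuousOn hm.continuousOn
    hl.continuousOn bp bl0
  have g2 := continuousOn_gap (K := B) hp.continuousOn ha.continuousOn hm'.continuousOn
    hl' bp bl'0
  have hM : ContinuousOn (fun z => l z ^ m z) B :=
    hl.continuousOn.rpow hm.continuousOn fun z hz => Or.inl (bl0 z hz).ne'
  have hM' : ContinuousOn (fun z => l' z ^ m' z) B :=
    hl'.rpow hm'.continuousOn fun z hz => Or.inl (bl'0 z hz).ne'
  have s1 := continuousOn_slack (K := B) hp.continuousOn ha.continuousOn hM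
    hl.continuousOn hr.continuousOn bp bl0
  have s2 := continuousOn_slack (K := B) hp.continuousOn ha.continuousOn hM' hl' hr' bp bl'0
  set K : Set (ℝ × ℝ × ℝ × ℝ × ℝ × ℝ) := B ∩ ((B ∩ (fun z => gap (p z) (a z) (m z) (l z)) ⁻¹'
    Set.Ici 0) ∩ (B ∩ (fun z => gap (p z) (a z) (m' z) (l' z)) ⁻¹' Set.Ici 0) ∩
    {z | m' z ≤ m z}) with hK
  have hKc : IsCompact K := hBc.inter_right
    (((g1.preimage_isClosed_of_isClosed hBc.isClosed isClosed_Ici).inter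
    (g2.preimage_isClosed_of_isClosed hBc.isClosed isClosed_Ici)).inter
    (isClosed_le hm' hm))
  have hKB : K ⊆ B := Set.inter_subset_left
  have n1 : ∀ z ∈ K, 0 ≤ slack (p z) (a z) (l z ^ m z) (l z) (r z) := fun z hz =>
    slack_nonneg_of_gap (bp z hz.1) (bl0 z hz.1) (br z hz.1) hz.2.1.1.2
  have n2 : ∀ z ∈ K, 0 ≤ slack (p z) (a z) (l' z ^ m' z) (l' z) (r' z) := fun z hz =>
    slack_nonneg_of_gap (bp z hz.1) (bl'0 z hz.1)
      (by have := br z hz.1; show 0 ≤ 2 * r z / (1 + r z); positivity) hz.2.1.2.2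
  have hZ : Continuous fun z => (1 - 2 * m z) * (p z * (r z - 1 - a z * (l z - 1))) := by
    fun_prop
  obtain ⟨N, c, hN, hc, hNc⟩ := hKc.exists_mul_add_ge ((s1.add s2).mono hKB) hZ.continuousOn
    (fun z hz => add_nonneg (n1 z hz) (n2 z hz))
    (fun z hz h0 => by
      have k1 := n1 z hz
      have k2 := n2 z hz
      replace h0 : slack (p z) (a z) (l z ^ m z) (l z) (r z) +
        slack (p z) (a z) (l' z ^ m' z) (l' z) (r' z) = 0 := h0
      exact sign_of_slack_eq_zero (bp z hz.1) (lt_of_lt_of_le ha₀ hz.1.2.1.1)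
        (lt_of_le_of_lt hz.1.2.1.2 ha₁) hz.1.2.2.1.1 hz.1.2.2.1.2 hz.2.2 (bl z hz.1) (br z hz.1)
        hz.2.1.1.2 hz.2.1.2.2 (by linarith) (by
          have : slack (p z) (a z) (l' z ^ m' z) (l' z) (r' z) = 0 := by linarith
          exact this))
  refine ⟨N, c, hN, hc, fun p' a' m₁ m₂ l₁ r₁ h1 h2 h3 h4 h5 h6 h7 h8 h9 h10 h11 => ?_⟩
  have hmem : (p', a', m₁, m₂, l₁, r₁) ∈ B :=
    ⟨h1, h2, ⟨h3.trans h4, h5⟩, ⟨h3, h4.trans h5⟩, ⟨h6, h7⟩, ⟨h8, h9⟩⟩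
  exact hNc (p', a', m₁, m₂, l₁, r₁) ⟨hmem, ⟨⟨hmem, h10⟩, ⟨hmem, h11⟩⟩, h4⟩

end VarMixed

/-! ### Admissible levels and the first-order inequality -/

namespace VarMixed

section Admissible

variable {X : Type*} [MeasurableSpace X]

/-- The modular of `u / l ^ a` in `L^P` is at most one. -/
def Adm (μ : Measure X) (P a : X → ℝ) (u : X → ℝ) (l : ℝ) : Prop :=
  0 < l ∧ ∫⁻ x, ENNReal.ofReal ((l ^ (-a x) * u x) ^ P x) ∂μ ≤ 1

/-- Measurable exponents `P` and `1 / a` that are uniformly bounded away from `1` and `∞`. -/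
structure ExponentBounds (P a : X → ℝ) (p₀ p₁ a₀ a₁ : ℝ) : Prop where
  one_lt : 1 < p₀
  pos : 0 < a₀
  lt_one : a₁ < 1
  measurable_P : Measurable P
  measurable_a : Measurable a
  P_mem : ∀ x, P x ∈ Set.Icc p₀ p₁
  a_mem : ∀ x, a x ∈ Set.Icc a₀ a₁

/-- Bounded exponents for which the functional `u ↦ inf {l | Adm μ P a u l}` is midpoint convex. -/
structure ConvexLayer (μ : Measure X) (P a : X → ℝ) (p₀ p₁ a₀ a₁ : ℝ) : Prop extends
    ExponentBounds P a p₀ p₁ a₀ a₁ where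
  convex : ∀ u v : X → ℝ, ∀ s t : ℝ, Measurable u → Measurable v → (∀ x, 0 ≤ u x) →
    (∀ x, 0 ≤ v x) → Adm μ P a u s → Adm μ P a v t →
    Adm μ P a (fun x => (u x + v x) / 2) ((s + t) / 2)

theorem integrable_of_lintegral_ofReal_le {μ : Measure X} {h : X → ℝ} (hm : Measurable h)
    (h0 : ∀ x, 0 ≤ h x) (hle : ∫⁻ x, ENNReal.ofReal (h x) ∂μ ≤ 1) :
    Integrable h μ ∧ ∫ x, h x ∂μ ≤ 1 := by
  refine ⟨⟨hm.aestronglyMeasurable, ?_⟩, ?_⟩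
  · rw [hasFiniteIntegral_iff_ofReal (Filter.Eventually.of_forall h0)]
    exact hle.trans_lt ENNReal.one_lt_top
  · rw [integral_eq_lintegral_of_nonneg_ae (Filter.Eventually.of_forall h0)
      hm.aestronglyMeasurable]
    exact ENNReal.toReal_le_of_le_ofReal zero_le_one (by simpa using hle)

theorem integrable_mul_of_abs_le {μ : Measure X} {w g : X → ℝ} {C : ℝ} (hw : Integrable w μ)
    (hg : Measurable g) (hC : ∀ x, |g x| ≤ C) : Integrable (fun x => w x * g x) μ :=
  hw.mul_bdd hg.aestronglyMeasurable (Filter.Eventually.of_forall hC)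

theorem mul_rpow_inv_rpow {w y c P : ℝ} (hw : 0 ≤ w) (hy : 0 ≤ y) (hc : 0 ≤ c) (hP : 0 < P) :
    (c * (w ^ P⁻¹ * y)) ^ P = w * (c * y) ^ P := by
  have h1 : (0 : ℝ) ≤ w ^ P⁻¹ := Real.rpow_nonneg hw _
  rw [mul_left_comm, Real.mul_rpow h1 (mul_nonneg hc hy), Real.rpow_inv_rpow hw hP.ne']

variable {μ : Measure X} {P a : X → ℝ} {p₀ p₁ a₀ a₁ : ℝ}

namespace ExponentBounds

variable (H : ExponentBounds P a p₀ p₁ a₀ a₁)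
include H

theorem one_lt_P (x : X) : 1 < P x := H.one_lt.trans_le (H.P_mem x).1
theorem P_pos (x : X) : 0 < P x := one_pos.trans (H.one_lt_P x)
theorem a_pos (x : X) : 0 < a x := H.pos.trans_le (H.a_mem x).1
theorem a_lt_one (x : X) : a x < 1 := (H.a_mem x).2.trans_lt H.lt_one

theorem measurable_weight {f : X → ℝ} {l : ℝ} (hf : Measurable f) :
    Measurable fun x => (l ^ (-a x) * f x) ^ P x :=
  ((measurable_const.pow H.measurable_a.neg).mul hf).pow H.measurable_P

theorem adm_mono {f g : X → ℝ} {l l' : ℝ} (hf0 : ∀ x, 0 ≤ f x) (hfg : ∀ x, f x ≤ g x)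
    (h : Adm μ P a g l) (hl : l ≤ l') : Adm μ P a f l' := by
  refine ⟨h.1.trans_le hl, (lintegral_mono fun x => ENNReal.ofReal_le_ofReal ?_).trans h.2⟩
  refine Real.rpow_le_rpow (mul_nonneg (Real.rpow_nonneg (h.1.trans_le hl).le _) (hf0 x)) ?_
    (H.P_pos x).le
  exact mul_le_mul (Real.rpow_le_rpow_of_nonpos h.1 hl (neg_nonpos.2 (H.a_pos x).le)) (hfg x)
    (hf0 x) (Real.rpow_nonneg h.1.le _)

/-- Lowering the level by the factor c multiplies the weight by c^(-a P), and a P ≤ p₁ because a <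
1. -/
theorem weight_mul_le {y l c : ℝ} (hy : 0 ≤ y) (hl : 0 < l) (hc : 0 < c) (hc1 : c ≤ 1) (x : X) :
    ((c * l) ^ (-a x) * y) ^ P x ≤ c ^ (-p₁) * (l ^ (-a x) * y) ^ P x := by
  have h0 : 0 ≤ l ^ (-a x) * y := by positivity
  rw [Real.mul_rpow hc.le hl.le, mul_assoc, Real.mul_rpow (by positivity) h0, ← Real.rpow_mul hc.le]
  refine mul_le_mul_of_nonneg_right ?_ (Real.rpow_nonneg h0 _)
  refine Real.rpow_le_rpow_of_exponent_ge hc hc1 ?_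
  have := H.P_pos x
  have := (H.P_mem x).2
  nlinarith [H.a_lt_one x, H.a_pos x]

theorem adm_of_lintegral_le {f : X → ℝ} {l c : ℝ} (hf0 : ∀ x, 0 ≤ f x) (hl : 0 < l) (hc : 0 < c)
    (hc1 : c ≤ 1) (h : ∫⁻ x, ENNReal.ofReal ((l ^ (-a x) * f x) ^ P x) ∂μ ≤
      ENNReal.ofReal (c ^ p₁)) : Adm μ P a f (c * l) := by
  refine ⟨mul_pos hc hl, ?_⟩
  calc ∫⁻ x, ENNReal.ofReal (((c * l) ^ (-a x) * f x) ^ P x) ∂μ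
      ≤ ∫⁻ x, ENNReal.ofReal (c ^ (-p₁)) * ENNReal.ofReal ((l ^ (-a x) * f x) ^ P x) ∂μ := by
        refine lintegral_mono fun x => ?_
        rw [← ENNReal.ofReal_mul (by positivity)]
        exact ENNReal.ofReal_le_ofReal (H.weight_mul_le (hf0 x) hl hc hc1 x)
    _ = ENNReal.ofReal (c ^ (-p₁)) * ∫⁻ x, ENNReal.ofReal ((l ^ (-a x) * f x) ^ P x) ∂μ :=
        lintegral_const_mul' _ _ ENNReal.ofReal_ne_top
    _ ≤ ENNReal.ofReal (c ^ (-p₁)) * ENNReal.ofReal (c ^ p₁) := by gcongr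
    _ = 1 := by
        rw [← ENNReal.ofReal_mul (by positivity), ← Real.rpow_add hc]; simp

theorem adm_const_mul {f : X → ℝ} {l c : ℝ} (hf0 : ∀ x, 0 ≤ f x) (hc : 1 ≤ c)
    (h : Adm μ P a f l) : Adm μ P a (fun x => c * f x) (c ^ a₀⁻¹ * l) := by
  have hl := h.1
  have hc0 : 0 < c := by linarith
  refine ⟨by positivity, (lintegral_mono fun x => ENNReal.ofReal_le_ofReal ?_).trans h.2⟩
  refine Real.rpow_le_rpow (mul_nonneg (by positivity) (mul_nonneg hc0.le (hf0 x))) ?_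
    (H.P_pos x).le
  have h1 : (c ^ a₀⁻¹) ^ (-a x) ≤ c⁻¹ := by
    rw [← Real.rpow_mul hc0.le]
    refine (Real.rpow_le_rpow_of_exponent_le hc ?_).trans_eq (Real.rpow_neg_one c)
    have : a₀⁻¹ * a₀ ≤ a₀⁻¹ * a x :=
      mul_le_mul_of_nonneg_left (H.a_mem x).1 (inv_nonneg.2 H.pos.le)
    rw [inv_mul_cancel₀ H.pos.ne'] at this
    linarith
  rw [Real.mul_rpow (by positivity) hl.le]
  have h2 : 0 ≤ l ^ (-a x) * f x := mul_nonneg (by positivity) (hf0 x)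
  calc (c ^ a₀⁻¹) ^ (-a x) * l ^ (-a x) * (c * f x)
      = (c ^ a₀⁻¹) ^ (-a x) * (c * (l ^ (-a x) * f x)) := by ring
    _ ≤ c⁻¹ * (c * (l ^ (-a x) * f x)) :=
        mul_le_mul_of_nonneg_right h1 (mul_nonneg hc0.le h2)
    _ = l ^ (-a x) * f x := by field_simp

end ExponentBounds

namespace ConvexLayer

variable (H : ConvexLayer μ P a p₀ p₁ a₀ a₁)
include H

/-- Repeated halving towards u. Only the parameters 2^(-k) are reached, which suffices for
differentiating at u. -/
theorem adm_interpolate {u v : X → ℝ} {s t : ℝ} (hu : Measurable u) (hv : Measurable v)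
    (hu0 : ∀ x, 0 ≤ u x) (hv0 : ∀ x, 0 ≤ v x) (h1 : Adm μ P a u s) (h2 : Adm μ P a v t) (k : ℕ) :
    Adm μ P a (fun x => u x + (1 / 2 : ℝ) ^ k * (v x - u x)) (s + (1 / 2 : ℝ) ^ k * (t - s)) := by
  induction k with
  | zero => simpa using h2
  | succ k ih =>
    have h := H.convex _ _ _ _ hu (by fun_prop) hu0 (fun x => ?_) h1 ih
    · convert h using 1
      · funext x; ring
      · ring
    · have h3 : (1 / 2 : ℝ) ^ k ≤ 1 := pow_le_one₀ (by norm_num) (by norm_num)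
      have h4 : (0 : ℝ) ≤ (1 / 2 : ℝ) ^ k := by positivity
      nlinarith [mul_nonneg (sub_nonneg.2 h3) (hu0 x), mul_nonneg h4 (hv0 x)]

/-- The function w^(1/P) has modular exactly 1 at level 1. Moving a fraction θ towards w^(1/P) ρ at
level l keeps the modular at most 1, and its expansion is 1 + θ ∫ w P (ρ - 1 - a (l - 1)) up to
O(θ²). Divide by θ and let θ tend to 0. -/
theorem integral_first_order_nonpos {w ρ : X → ℝ} {l R : ℝ} (hw : Measurable w)
    (hw0 : ∀ x, 0 ≤ w x) (hwi : Integrable w μ) (hw1 : ∫ x, w x ∂μ = 1) (hρ : Measurable ρ)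
    (hρ0 : ∀ x, 0 ≤ ρ x) (hρR : ∀ x, ρ x ≤ R) (hl : 0 < l)
    (hle : ∫⁻ x, ENNReal.ofReal (w x * (l ^ (-a x) * ρ x) ^ P x) ∂μ ≤ 1) :
    ∫ x, w x * (P x * (ρ x - 1 - a x * (l - 1))) ∂μ ≤ 0 := by
  have hPm := H.measurable_P
  have ham := H.measurable_a
  have A1 : Adm μ P a (fun x => w x ^ (P x)⁻¹) 1 := by
    refine ⟨one_pos, ?_⟩
    have : ∀ x, ((1 : ℝ) ^ (-a x) * w x ^ (P x)⁻¹) ^ P x = w x := fun x => by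
      rw [Real.one_rpow, one_mul, Real.rpow_inv_rpow (hw0 x) (H.P_pos x).ne']
    simp_rw [this]
    rw [← ofReal_integral_eq_lintegral_ofReal hwi (Filter.Eventually.of_forall hw0), hw1]
    simp
  have A2 : Adm μ P a (fun x => w x ^ (P x)⁻¹ * ρ x) l := by
    refine ⟨hl, ?_⟩
    simp_rw [fun x => mul_rpow_inv_rpow (hw0 x) (hρ0 x) (Real.rpow_nonneg hl.le (-a x))
      (H.P_pos x)]
    exact hle
  have hwP : Measurable fun x => w x ^ (P x)⁻¹ := hw.pow hPm.inv
  set C : ℝ := 2 * p₁ * |l - 1| * (R + 1 + |l - 1|) with hC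
  have ybd : ∀ x, |ρ x - 1 - a x * (l - 1)| ≤ R + 1 + |l - 1| := fun x => by
    have e1 : |a x * (l - 1)| ≤ |l - 1| := by
      rw [abs_mul, abs_of_pos (H.a_pos x)]
      exact mul_le_of_le_one_left (abs_nonneg _) (H.a_lt_one x).le
    have e2 := abs_le.1 e1
    rw [abs_le]
    constructor <;> linarith [hρ0 x, hρR x]
  have hDm : Measurable fun x => P x * (ρ x - 1 - a x * (l - 1)) := by fun_prop
  have main : ∀ k : ℕ, ∫ x, w x * (P x * (ρ x - 1 - a x * (l - 1))) ∂μ ≤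
      C * (1 / 2 : ℝ) ^ (k + 1) := by
    intro k
    -- Starting at k + 1 ensures θ ≤ 1/2, which keeps the denominator 1 + a θ (l - 1) at least 1/2.
    set θ : ℝ := (1 / 2 : ℝ) ^ (k + 1) with hθ
    have hθ0 : 0 < θ := by positivity
    have hθ1 : θ ≤ 1 / 2 := by
      rw [hθ, pow_succ]
      have : (1 / 2 : ℝ) ^ k ≤ 1 := pow_le_one₀ (by norm_num) (by norm_num)
      linarith
    have A3 := H.adm_interpolate hwP (hwP.mul hρ) (fun x => Real.rpow_nonneg (hw0 x) _)
      (fun x => mul_nonneg (Real.rpow_nonneg (hw0 x) _) (hρ0 x)) A1 A2 (k + 1)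
    rw [← hθ] at A3
    set L : ℝ := 1 + θ * (l - 1) with hL
    have hL0 : 0 < L := A3.1
    have hy0 : ∀ x, 0 ≤ 1 + θ * (ρ x - 1) := fun x => by
      nlinarith [mul_nonneg hθ0.le (hρ0 x)]
    have e1 : ∀ x, (L ^ (-a x) * (w x ^ (P x)⁻¹ + θ * (w x ^ (P x)⁻¹ * ρ x - w x ^ (P x)⁻¹))) ^ P x
        = w x * (L ^ (-a x) * (1 + θ * (ρ x - 1))) ^ P x := fun x => by
      rw [← mul_rpow_inv_rpow (hw0 x) (hy0 x) (Real.rpow_nonneg hL0.le (-a x)) (H.P_pos x)]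
      congr 1; ring
    have A4 : ∫⁻ x, ENNReal.ofReal (w x * (L ^ (-a x) * (1 + θ * (ρ x - 1))) ^ P x) ∂μ ≤ 1 :=
      (lintegral_congr fun x => congrArg ENNReal.ofReal (e1 x).symm).trans_le A3.2
    obtain ⟨i1, i2⟩ := integrable_of_lintegral_ofReal_le
      (hw.mul (((measurable_const.pow ham.neg).mul
        (measurable_const.add (measurable_const.mul (hρ.sub measurable_const)))).pow hPm))
      (fun x => mul_nonneg (hw0 x) (Real.rpow_nonneg (mul_nonneg
        (Real.rpow_nonneg hL0.le _) (hy0 x)) _)) A4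
    have den : ∀ x, 1 / 2 ≤ 1 + a x * (θ * (l - 1)) := fun x => by
      have := mul_nonneg (H.a_pos x).le (mul_nonneg hθ0.le hl.le)
      have h2 : a x * θ ≤ 1 * (1 / 2) :=
        mul_le_mul (H.a_lt_one x).le hθ1 hθ0.le zero_le_one
      nlinarith
    -- The expansion from below: Bernoulli for the outer power P, then L^a ≤ 1 + a θ (l - 1) in the
    -- denominator; the second-order remainder is absorbed by C θ.
    have pt : ∀ x, w x * (1 + θ * (P x * (ρ x - 1 - a x * (l - 1)) - C * θ)) ≤
        w x * (L ^ (-a x) * (1 + θ * (ρ x - 1))) ^ P x := by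
      intro x
      refine mul_le_mul_of_nonneg_left ?_ (hw0 x)
      have b1 := bernoulli_rpow (x := L ^ (-a x) * (1 + θ * (ρ x - 1)))
        (mul_nonneg (Real.rpow_nonneg hL0.le _) (hy0 x)) (H.one_lt_P x).le
      have b2 := bernoulli_rpow_concave hL0.le (H.a_pos x).le (H.a_lt_one x).le
      have hLa : 0 < L ^ a x := Real.rpow_pos_of_pos hL0 _
      set d := 1 + a x * (θ * (l - 1)) with hd
      have hd0 : 0 < d := by linarith [den x]
      have b2' : L ^ a x ≤ d := by rw [hd]; rw [hL] at b2 ⊢; linarith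
      have b3 : (1 + θ * (ρ x - 1)) / d ≤ L ^ (-a x) * (1 + θ * (ρ x - 1)) := by
        rw [Real.rpow_neg hL0.le, div_eq_mul_inv, mul_comm]
        exact mul_le_mul_of_nonneg_right (inv_anti₀ hLa b2') (hy0 x)
      set Y := ρ x - 1 - a x * (l - 1) with hY
      have b4 : (1 + θ * (ρ x - 1)) / d - 1 = θ * Y - θ * (a x * (θ * (l - 1)) * Y / d) := by
        field_simp
        rw [hY, hd]; ring
      have b5 : a x * (θ * (l - 1)) * Y / d ≤ 2 * θ * |l - 1| * (R + 1 + |l - 1|) := by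
        rw [div_le_iff₀ hd0]
        have c1 : a x * (θ * (l - 1)) * Y ≤ θ * |l - 1| * (R + 1 + |l - 1|) := by
          refine (le_abs_self _).trans ?_
          rw [abs_mul, abs_mul, abs_mul, abs_of_pos (H.a_pos x), abs_of_pos hθ0]
          refine mul_le_mul ?_ (ybd x) (abs_nonneg _) (by positivity)
          exact mul_le_of_le_one_left (by positivity) (H.a_lt_one x).le
        have c2 : 0 ≤ θ * |l - 1| * (R + 1 + |l - 1|) := by
          have := (abs_nonneg _).trans (ybd x)
          positivity
        nlinarith [den x]
      have b6 : P x * (a x * (θ * (l - 1)) * Y / d) ≤ C * θ := by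
        have c2 : 0 ≤ 2 * θ * |l - 1| * (R + 1 + |l - 1|) := by
          have := (abs_nonneg _).trans (ybd x)
          positivity
        calc P x * (a x * (θ * (l - 1)) * Y / d)
            ≤ P x * (2 * θ * |l - 1| * (R + 1 + |l - 1|)) :=
              mul_le_mul_of_nonneg_left b5 (H.P_pos x).le
          _ ≤ p₁ * (2 * θ * |l - 1| * (R + 1 + |l - 1|)) :=
              mul_le_mul_of_nonneg_right (H.P_mem x).2 c2
          _ = C * θ := by rw [hC]; ring
      have b7 : P x * ((1 + θ * (ρ x - 1)) / d - 1) ≤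
          P x * (L ^ (-a x) * (1 + θ * (ρ x - 1)) - 1) :=
        mul_le_mul_of_nonneg_left (by linarith) (H.P_pos x).le
      rw [b4] at b7
      have b8 := mul_le_mul_of_nonneg_left b6 hθ0.le
      nlinarith
    have bdd : ∀ x, |P x * (ρ x - 1 - a x * (l - 1))| ≤ p₁ * (R + 1 + |l - 1|) := fun x => by
      rw [abs_mul, abs_of_pos (H.P_pos x)]
      exact mul_le_mul (H.P_mem x).2 (ybd x) (abs_nonneg _)
        ((H.P_pos x).le.trans (H.P_mem x).2)
    have j1 := integrable_mul_of_abs_le hwi hDm bdd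
    have j2 : Integrable (fun x => w x * (1 + θ * (P x * (ρ x - 1 - a x * (l - 1)) - C * θ))) μ := by
      have : Integrable (fun x => (1 - θ * (C * θ)) * w x +
          θ * (w x * (P x * (ρ x - 1 - a x * (l - 1))))) μ :=
        (hwi.const_mul _).add (j1.const_mul _)
      convert this using 1
      funext x; ring
    have j3 := (integral_mono j2 i1 pt).trans i2
    have j4 : ∫ x, w x * (1 + θ * (P x * (ρ x - 1 - a x * (l - 1)) - C * θ)) ∂μ =
        (1 - θ * (C * θ)) + θ * ∫ x, w x * (P x * (ρ x - 1 - a x * (l - 1))) ∂μ := by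
      rw [show (fun x => w x * (1 + θ * (P x * (ρ x - 1 - a x * (l - 1)) - C * θ))) =
        fun x => (1 - θ * (C * θ)) * w x + θ * (w x * (P x * (ρ x - 1 - a x * (l - 1)))) from
          funext fun x => by ring, integral_add (hwi.const_mul _) (j1.const_mul _),
        integral_const_mul, integral_const_mul, hw1, mul_one]
    rw [j4] at j3
    have j5 : θ * ∫ x, w x * (P x * (ρ x - 1 - a x * (l - 1))) ∂μ ≤ θ * (C * θ) := by linarith
    exact le_of_mul_le_mul_left j5 hθ0
  have lim : Filter.Tendsto (fun k : ℕ => C * (1 / 2 : ℝ) ^ (k + 1)) Filter.atTop (nhds 0) := by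
    have := ((tendsto_pow_atTop_nhds_zero_of_lt_one (r := (1 / 2 : ℝ)) (by norm_num)
      (by norm_num)).comp (Filter.tendsto_add_atTop_nat 1)).const_mul C
    simpa using this
  exact ge_of_tendsto' lim main

end ConvexLayer

end Admissible

end VarMixed

/-! ### The Lagrange multiplier -/

namespace VarMixed

theorem mul_rpow_div_le_add {α β r s y p : ℝ} (hα : 0 ≤ α) (hβ : 0 ≤ β) (hr : 0 ≤ r) (hs : 0 ≤ s)
    (hy : 0 ≤ y) (hp : 1 ≤ p) :
    (α + β) * (y * ((α * r + β * s) / (α + β))) ^ p ≤ α * (y * r) ^ p + β * (y * s) ^ p := by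
  rcases (add_nonneg hα hβ).eq_or_lt with h | h
  · rw [← h, zero_mul]; positivity
  · have := (convexOn_rpow hp).2 (mul_nonneg hy hr) (mul_nonneg hy hs)
      (div_nonneg hα h.le) (div_nonneg hβ h.le) (by field_simp)
    simp only [smul_eq_mul] at this
    have h2 := mul_le_mul_of_nonneg_left this h.le
    calc (α + β) * (y * ((α * r + β * s) / (α + β))) ^ p
        = (α + β) * (α / (α + β) * (y * r) + β / (α + β) * (y * s)) ^ p := by
          congr 2; field_simp
      _ ≤ _ := h2
      _ = _ := by field_simp

theorem continuous_slack {p a M l : ℝ} (hp : 0 ≤ p) : Continuous fun r => slack p a M l r := by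
  unfold slack
  exact (continuous_const.mul (((continuous_const.mul continuous_id).rpow_const
    fun x => Or.inr hp).sub continuous_const)).sub (by fun_prop)

theorem rpow_mem_Icc_min_max {l a : ℝ} (hl : 0 < l) (ha0 : 0 ≤ a) (ha1 : a ≤ 1) :
    l ^ a ∈ Set.Icc (min 1 l) (max 1 l) := by
  rcases le_total 1 l with h | h
  · rw [min_eq_left h, max_eq_right h]
    exact ⟨Real.one_le_rpow h ha0, by simpa using Real.rpow_le_rpow_of_exponent_le h ha1⟩
  · rw [min_eq_right h, max_eq_left h]
    exact ⟨by simpa using Real.rpow_le_rpow_of_exponent_ge hl h ha1, Real.rpow_le_one hl.le h ha0⟩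

section

variable {X : Type*} [MeasurableSpace X] {μ : Measure X} {P a : X → ℝ} {p₀ p₁ a₀ a₁ : ℝ}

namespace ConvexLayer

variable (H : ConvexLayer μ P a p₀ p₁ a₀ a₁)
include H

theorem exists_rpow_bound {l r : ℝ} (hl : 0 < l) (hr : 0 ≤ r) :
    ∃ C, ∀ x, |(l ^ (-a x) * r) ^ P x| ≤ C := by
  refine ⟨(max 1 ((max 1 l⁻¹) * r)) ^ p₁, fun x => ?_⟩
  have h1 : l ^ (-a x) ≤ max 1 l⁻¹ := by
    rw [Real.rpow_neg hl.le, ← Real.inv_rpow hl.le]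
    exact (rpow_mem_Icc_min_max (inv_pos.2 hl) (H.a_pos x).le (H.a_lt_one x).le).2
  have h2 : 0 ≤ l ^ (-a x) * r := by positivity
  rw [abs_of_nonneg (Real.rpow_nonneg h2 _)]
  calc (l ^ (-a x) * r) ^ P x ≤ (max 1 ((max 1 l⁻¹) * r)) ^ P x :=
        Real.rpow_le_rpow h2 ((mul_le_mul_of_nonneg_right h1 hr).trans (le_max_right _ _))
          (H.P_pos x).le
    _ ≤ _ := Real.rpow_le_rpow_of_exponent_le (le_max_left _ _) (H.P_mem x).2

theorem measurable_rpow_P {l r : ℝ} : Measurable fun x => (l ^ (-a x) * r) ^ P x :=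
  ((measurable_const.pow H.measurable_a.neg).mul measurable_const).pow H.measurable_P

theorem measurable_slack {M l r : ℝ} : Measurable fun x => slack (P x) (a x) M l r := by
  have h1 := H.measurable_rpow_P (l := l) (r := r)
  have := H.measurable_P
  have := H.measurable_a
  unfold slack
  fun_prop

/-- A candidate α cannot be too small at one place and too large at another. Otherwise put mass on
both sets so that the excess of the constraint on one balances the deficit on the other: the
competitor stays admissible, but negative slack makes its first-order term positive, against
`integral_first_order_nonpos`. -/
theorem measure_slack_neg_eq_zero_or [SigmaFinite μ] {l α r s : ℝ} (hl : 0 < l) (hr : 0 ≤ r)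
    (hs : 0 ≤ s) :
    μ {x | 0 ≤ (l ^ (-a x) * r) ^ P x - 1 ∧ slack (P x) (a x) α l r < 0} = 0 ∨
    μ {x | (l ^ (-a x) * s) ^ P x - 1 ≤ 0 ∧ slack (P x) (a x) α l s < 0} = 0 := by
  by_contra hcon
  push Not at hcon
  obtain ⟨hA, hB⟩ := hcon
  have mr := H.measurable_rpow_P (l := l) (r := r)
  have ms := H.measurable_rpow_P (l := l) (r := s)
  have hPm := H.measurable_P
  have ham := H.measurable_a
  obtain ⟨A, mA, sA, pA, fA⟩ := Measure.exists_subset_measure_lt_top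
    ((measurableSet_le measurable_const (mr.sub_const 1)).inter
      (measurableSet_lt H.measurable_slack measurable_const)) (pos_iff_ne_zero.2 hA)
  obtain ⟨B, mB, sB, pB, fB⟩ := Measure.exists_subset_measure_lt_top
    ((measurableSet_le (ms.sub_const 1) measurable_const).inter
      (measurableSet_lt H.measurable_slack measurable_const)) (pos_iff_ne_zero.2 hB)
  set i : X → ℝ := A.indicator 1 with hi
  set j : X → ℝ := B.indicator 1 with hj
  have ii : Integrable i μ := (integrable_indicator_iff mA).2
    (integrableOn_const (hs := fA.ne))
  have ij : Integrable j μ := (integrable_indicator_iff mB).2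
    (integrableOn_const (hs := fB.ne))
  have mi : Measurable i := measurable_one.indicator mA
  have mj : Measurable j := measurable_one.indicator mB
  have i0 : ∀ x, 0 ≤ i x := fun x => Set.indicator_nonneg (fun _ _ => zero_le_one) x
  have j0 : ∀ x, 0 ≤ j x := fun x => Set.indicator_nonneg (fun _ _ => zero_le_one) x
  obtain ⟨Cr, hCr⟩ := H.exists_rpow_bound hl hr
  obtain ⟨Cs, hCs⟩ := H.exists_rpow_bound hl hs
  have Ir := integrable_mul_of_abs_le ii mr hCr
  have Is := integrable_mul_of_abs_le ij ms hCs
  have kbd : ∀ t : ℝ, 0 ≤ t → ∀ x, |P x * (t - 1 - a x * (l - 1))| ≤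
      p₁ * (t + 1 + |l - 1|) := fun t ht x => by
    rw [abs_mul, abs_of_pos (H.P_pos x)]
    refine mul_le_mul (H.P_mem x).2 ?_ (abs_nonneg _) ((H.P_pos x).le.trans (H.P_mem x).2)
    have e1 : |a x * (l - 1)| ≤ |l - 1| := by
      rw [abs_mul, abs_of_pos (H.a_pos x)]
      exact mul_le_of_le_one_left (abs_nonneg _) (H.a_lt_one x).le
    have e2 := abs_le.1 e1
    rw [abs_le]
    constructor <;> linarith
  have Kr := integrable_mul_of_abs_le ii (g := fun x => P x * (r - 1 - a x * (l - 1)))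
    (by fun_prop) (kbd r hr)
  have Ks := integrable_mul_of_abs_le ij (g := fun x => P x * (s - 1 - a x * (l - 1)))
    (by fun_prop) (kbd s hs)
  have Iint : 0 < ∫ x, i x ∂μ := by
    rw [integral_indicator_one mA]
    exact ENNReal.toReal_pos pA.ne' fA.ne
  have Jint : 0 < ∫ x, j x ∂μ := by
    rw [integral_indicator_one mB]
    exact ENNReal.toReal_pos pB.ne' fB.ne
  have hx1 : 0 ≤ ∫ x, i x * (l ^ (-a x) * r) ^ P x ∂μ - ∫ x, i x ∂μ := by
    rw [sub_nonneg]
    refine integral_mono ii Ir fun x => ?_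
    by_cases hx : x ∈ A
    · have h1 : 0 ≤ (l ^ (-a x) * r) ^ P x - 1 := (sA hx).1
      simp only [hi, Set.indicator_of_mem hx, Pi.one_apply]
      linarith
    · simp [hi, hx]
  have hx2 : 0 ≤ ∫ x, j x ∂μ - ∫ x, j x * (l ^ (-a x) * s) ^ P x ∂μ := by
    rw [sub_nonneg]
    refine integral_mono Is ij fun x => ?_
    by_cases hx : x ∈ B
    · have h1 : (l ^ (-a x) * s) ^ P x - 1 ≤ 0 := (sB hx).1
      simp only [hj, Set.indicator_of_mem hx, Pi.one_apply]
      linarith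
    · simp [hj, hx]
  have negint : ∀ (D : Set X) (t : ℝ), μ D ≠ 0 → (∀ x ∈ D, slack (P x) (a x) α l t < 0) →
      Integrable (D.indicator (1 : X → ℝ)) μ →
      Integrable (fun x => D.indicator (1 : X → ℝ) x * (l ^ (-a x) * t) ^ P x) μ →
      Integrable (fun x => D.indicator (1 : X → ℝ) x * (P x * (t - 1 - a x * (l - 1)))) μ →
      α * (∫ x, D.indicator (1 : X → ℝ) x * (l ^ (-a x) * t) ^ P x ∂μ -
        ∫ x, D.indicator (1 : X → ℝ) x ∂μ) <
        ∫ x, D.indicator (1 : X → ℝ) x * (P x * (t - 1 - a x * (l - 1))) ∂μ := by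
    intro D t hD hneg k1 k2 k3
    have e : ∀ x, D.indicator (1 : X → ℝ) x * (P x * (t - 1 - a x * (l - 1))) -
        α * (D.indicator (1 : X → ℝ) x * (l ^ (-a x) * t) ^ P x - D.indicator (1 : X → ℝ) x) =
        D.indicator (1 : X → ℝ) x * (-slack (P x) (a x) α l t) := fun x => by
      unfold slack; ring
    have k5 : Integrable (fun x => D.indicator (1 : X → ℝ) x * (l ^ (-a x) * t) ^ P x -
        D.indicator (1 : X → ℝ) x) μ := k2.sub k1
    have k4 : Integrable (fun x => D.indicator (1 : X → ℝ) x * (P x * (t - 1 - a x * (l - 1))) -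
        α * (D.indicator (1 : X → ℝ) x * (l ^ (-a x) * t) ^ P x -
          D.indicator (1 : X → ℝ) x)) μ := k3.sub (k5.const_mul α)
    have : 0 < ∫ x, (D.indicator (1 : X → ℝ) x * (P x * (t - 1 - a x * (l - 1))) -
        α * (D.indicator (1 : X → ℝ) x * (l ^ (-a x) * t) ^ P x -
          D.indicator (1 : X → ℝ) x)) ∂μ := by
      rw [integral_pos_iff_support_of_nonneg _ k4]
      · refine lt_of_lt_of_le (pos_iff_ne_zero.2 hD) (measure_mono fun x hx => ?_)
        rw [Function.mem_support, e, Set.indicator_of_mem hx]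
        have := hneg x hx
        simp only [Pi.one_apply, one_mul]
        exact (neg_pos.2 this).ne'
      · intro x
        simp only [e, Pi.zero_apply]
        by_cases hx : x ∈ D
        · rw [Set.indicator_of_mem hx]
          have := hneg x hx
          simp only [Pi.one_apply, one_mul]
          linarith
        · simp [hx]
    rw [integral_sub k3 (k5.const_mul α), integral_const_mul, integral_sub k2 k1] at this
    linarith
  have N1 := negint A r pA.ne' (fun x hx => (sA hx).2) ii Ir Kr
  have N2 := negint B s pB.ne' (fun x hx => (sB hx).2) ij Is Ks
  rw [← hi] at N1
  rw [← hj] at N2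
  -- The masses are inversely proportional to excess and deficit, normalized to total mass 1. If the
  -- excess is zero, the first set alone serves.
  obtain ⟨c, d, hc, hd, hbal, hone⟩ : ∃ c d : ℝ, 0 ≤ c ∧ 0 ≤ d ∧
      c * (∫ x, i x * (l ^ (-a x) * r) ^ P x ∂μ - ∫ x, i x ∂μ) =
      d * (∫ x, j x ∂μ - ∫ x, j x * (l ^ (-a x) * s) ^ P x ∂μ) ∧
      c * ∫ x, i x ∂μ + d * ∫ x, j x ∂μ = 1 := by
    generalize (∫ x, i x * (l ^ (-a x) * r) ^ P x ∂μ - ∫ x, i x ∂μ) = y1 at hx1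
    generalize (∫ x, j x ∂μ - ∫ x, j x * (l ^ (-a x) * s) ^ P x ∂μ) = y2 at hx2
    rcases hx1.eq_or_lt with h1 | h1
    · exact ⟨(∫ x, i x ∂μ)⁻¹, 0, by positivity, le_rfl, by rw [← h1]; ring, by field_simp; ring⟩
    · set W := y2 * ∫ x, i x ∂μ + y1 * ∫ x, j x ∂μ with hW
      have hW0 : 0 < W := by positivity
      refine ⟨y2 / W, y1 / W, by positivity, by positivity, by ring, ?_⟩
      rw [div_mul_eq_mul_div, div_mul_eq_mul_div, ← add_div, ← hW, div_self hW0.ne']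
  set w : X → ℝ := fun x => c * i x + d * j x with hw
  -- The two sets may overlap; there ρ is the weighted mean of r and s, and convexity of the power
  -- controls its modular.
  set ρ : X → ℝ := fun x => (c * i x * r + d * j x * s) / (c * i x + d * j x) with hρ
  have iw : Integrable w μ := (ii.const_mul c).add (ij.const_mul d)
  have w0 : ∀ x, 0 ≤ w x := fun x => add_nonneg (mul_nonneg hc (i0 x)) (mul_nonneg hd (j0 x))
  have w1 : ∫ x, w x ∂μ = 1 := by
    rw [integral_add (ii.const_mul c) (ij.const_mul d), integral_const_mul, integral_const_mul,
      hone]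
  have wρ : ∀ x, w x * ρ x = c * i x * r + d * j x * s := fun x => by
    rcases (w0 x).eq_or_lt with h | h
    · have h1 := mul_nonneg hc (i0 x)
      have h2 := mul_nonneg hd (j0 x)
      have h3 : c * i x + d * j x = 0 := h.symm
      rw [← h, show c * i x = 0 by linarith, show d * j x = 0 by linarith]; ring
    · exact mul_div_cancel₀ _ h.ne'
  have ρ0 : ∀ x, 0 ≤ ρ x := fun x =>
    div_nonneg (add_nonneg (mul_nonneg (mul_nonneg hc (i0 x)) hr)
      (mul_nonneg (mul_nonneg hd (j0 x)) hs)) (w0 x)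
  have ρR : ∀ x, ρ x ≤ max r s := fun x => by
    refine div_le_of_le_mul₀ (w0 x) (hr.trans (le_max_left _ _)) ?_
    have h1 := mul_le_mul_of_nonneg_left (le_max_left r s) (mul_nonneg hc (i0 x))
    have h2 := mul_le_mul_of_nonneg_left (le_max_right r s) (mul_nonneg hd (j0 x))
    linarith
  have fin := H.integral_first_order_nonpos (w := w) (ρ := ρ) (l := l) (by fun_prop) w0 iw w1
    (by fun_prop) ρ0 ρR hl ?_
  · have e1 : ∀ x, w x * (P x * (ρ x - 1 - a x * (l - 1))) =
        c * (i x * (P x * (r - 1 - a x * (l - 1)))) +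
        d * (j x * (P x * (s - 1 - a x * (l - 1)))) := fun x => by
      have : w x * (P x * (ρ x - 1 - a x * (l - 1))) =
        P x * (w x * ρ x) - w x * (P x * (1 + a x * (l - 1))) := by ring
      rw [this, wρ, hw]
      ring
    simp_rw [e1] at fin
    rw [integral_add (Kr.const_mul c) (Ks.const_mul d), integral_const_mul,
      integral_const_mul] at fin
    have g1 := mul_le_mul_of_nonneg_left N1.le hc
    have g2 := mul_le_mul_of_nonneg_left N2.le hd
    have g3 : α * (c * (∫ x, i x * (l ^ (-a x) * r) ^ P x ∂μ - ∫ x, i x ∂μ)) =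
      α * (d * (∫ x, j x ∂μ - ∫ x, j x * (l ^ (-a x) * s) ^ P x ∂μ)) := by rw [hbal]
    have hcd : 0 < c ∨ 0 < d := by
      by_contra hcd
      push Not at hcd
      have : c = 0 := le_antisymm hcd.1 hc
      have : d = 0 := le_antisymm hcd.2 hd
      simp_all
    rcases hcd with h | h
    · have := mul_lt_mul_of_pos_left N1 h
      linarith
    · have := mul_lt_mul_of_pos_left N2 h
      linarith
  · have e2 : ∀ x, w x * (l ^ (-a x) * ρ x) ^ P x ≤
        c * (i x * (l ^ (-a x) * r) ^ P x) + d * (j x * (l ^ (-a x) * s) ^ P x) := fun x => by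
      have := mul_rpow_div_le_add (y := l ^ (-a x)) (mul_nonneg hc (i0 x)) (mul_nonneg hd (j0 x))
        hr hs (by positivity) (H.one_lt_P x).le
      rw [← mul_assoc, ← mul_assoc]
      exact this
    have k1 : Integrable (fun x => c * (i x * (l ^ (-a x) * r) ^ P x) +
        d * (j x * (l ^ (-a x) * s) ^ P x)) μ := (Ir.const_mul c).add (Is.const_mul d)
    calc ∫⁻ x, ENNReal.ofReal (w x * (l ^ (-a x) * ρ x) ^ P x) ∂μ
        ≤ ∫⁻ x, ENNReal.ofReal (c * (i x * (l ^ (-a x) * r) ^ P x) +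
          d * (j x * (l ^ (-a x) * s) ^ P x)) ∂μ :=
          lintegral_mono fun x => ENNReal.ofReal_le_ofReal (e2 x)
      _ = ENNReal.ofReal (∫ x, (c * (i x * (l ^ (-a x) * r) ^ P x) +
          d * (j x * (l ^ (-a x) * s) ^ P x)) ∂μ) := by
          rw [ofReal_integral_eq_lintegral_ofReal k1 (Filter.Eventually.of_forall fun x => ?_)]
          exact (mul_nonneg (w0 x) (Real.rpow_nonneg (mul_nonneg (Real.rpow_nonneg hl.le _)
            (ρ0 x)) _)).trans (e2 x)
      _ ≤ 1 := by
          rw [integral_add (Ir.const_mul c) (Is.const_mul d), integral_const_mul,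
            integral_const_mul, ENNReal.ofReal_le_one]
          linarith

/-- M is the supremum of the multipliers that are too small somewhere. Above M none is too small;
below M, by `measure_slack_neg_eq_zero_or`, none is too large. Both properties pass to M in the
limit, and at an endpoint of the interval comparison with the individual multiplier l^a replaces the
limit. -/
theorem exists_multiplier [SigmaFinite μ] {l : ℝ} (hl : 0 < l) :
    ∃ M ∈ Set.Icc (min 1 l) (max 1 l), ∀ᵐ x ∂μ, ∀ r, 0 ≤ r → 0 ≤ slack (P x) (a x) M l r := by
  set lo := min 1 l with hlo
  set hi := max 1 l with hhi
  have hlh : lo ≤ hi := min_le_max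
  set U : Set ℝ := {α | α ∈ Set.Icc lo hi ∧ ∃ r : ℝ, 0 ≤ r ∧
    μ {x | 0 ≤ (l ^ (-a x) * r) ^ P x - 1 ∧ slack (P x) (a x) α l r < 0} ≠ 0} with hU
  have hbdd : BddAbove (insert lo U) := ⟨hi, by
    rintro y (rfl | hy)
    · exact hlh
    · exact hy.1.2⟩
  -- Inserting lo keeps the set nonempty when no multiplier is too small.
  set M := sSup (insert lo U) with hM
  have hMlo : lo ≤ M := le_csSup hbdd (Set.mem_insert _ _)
  have hMhi : M ≤ hi := csSup_le (Set.insert_nonempty _ _) (by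
    rintro y (rfl | hy)
    · exact hlh
    · exact hy.1.2)
  have aff : ∀ x r α β, slack (P x) (a x) α l r - slack (P x) (a x) β l r =
      (α - β) * ((l ^ (-a x) * r) ^ P x - 1) := fun x r α β => by unfold slack; ring
  have good : ∀ x r, 0 ≤ r → 0 ≤ slack (P x) (a x) (l ^ a x) l r := fun x r hr =>
    slack_rpow_self_nonneg (H.one_lt_P x).le (H.a_pos x).le (H.a_lt_one x).le hl hr
  have mem : ∀ x, l ^ a x ∈ Set.Icc lo hi := fun x =>
    rpow_mem_Icc_min_max hl (H.a_pos x).le (H.a_lt_one x).le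
  have tends : ∀ x r y, Filter.Tendsto (fun k : ℕ => slack (P x) (a x) (M + y * (1 / ((k : ℝ) + 1)))
      l r) Filter.atTop (nhds (slack (P x) (a x) M l r)) := fun x r y => by
    have h1 := (tendsto_one_div_add_atTop_nhds_zero_nat (𝕜 := ℝ)).const_mul y
    have h2 : Continuous fun α => slack (P x) (a x) α l r := by unfold slack; fun_prop
    have h3 := (h2.tendsto (M + y * 0)).comp (tendsto_const_nhds.add h1)
    rw [mul_zero, add_zero] at h3
    exact h3
  have frac : ∀ k : ℕ, 0 < 1 / ((k : ℝ) + 1) ∧ 1 / ((k : ℝ) + 1) ≤ 1 := fun k =>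
    ⟨by positivity, by rw [div_le_one (by positivity)]; linarith [k.cast_nonneg (α := ℝ)]⟩
  have fixed : ∀ r : ℝ, 0 ≤ r → ∀ᵐ x ∂μ, 0 ≤ slack (P x) (a x) M l r := by
    intro r hr
    have up : ∀ᵐ x ∂μ, 0 ≤ (l ^ (-a x) * r) ^ P x - 1 → 0 ≤ slack (P x) (a x) M l r := by
      rcases hMhi.eq_or_lt with h | h
      · refine Filter.Eventually.of_forall fun x hx => ?_
        have h1 := aff x r M (l ^ a x)
        have h2 := mul_nonneg (sub_nonneg.2 ((mem x).2.trans h.ge)) hx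
        linarith [good x r hr]
      · have h1 : ∀ k : ℕ, ∀ᵐ x ∂μ, 0 ≤ (l ^ (-a x) * r) ^ P x - 1 →
            0 ≤ slack (P x) (a x) (M + (hi - M) * (1 / ((k : ℝ) + 1))) l r := by
          intro k
          obtain ⟨f0, f1⟩ := frac k
          have h2 : M + (hi - M) * (1 / ((k : ℝ) + 1)) ∉ U := fun hc => by
            have := le_csSup hbdd (Set.mem_insert_of_mem lo hc)
            have := mul_pos (sub_pos.2 h) f0
            linarith
          have h3 : μ {x | 0 ≤ (l ^ (-a x) * r) ^ P x - 1 ∧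
              slack (P x) (a x) (M + (hi - M) * (1 / ((k : ℝ) + 1))) l r < 0} = 0 := by
            by_contra hne
            refine h2 ⟨⟨?_, ?_⟩, r, hr, hne⟩
            · have := mul_pos (sub_pos.2 h) f0
              linarith
            · have := mul_le_mul_of_nonneg_left f1 (sub_nonneg.2 hMhi)
              linarith
          filter_upwards [measure_eq_zero_iff_ae_notMem.1 h3] with x hx h0
          by_contra hc
          exact hx ⟨h0, not_le.1 hc⟩
        filter_upwards [ae_all_iff.2 h1] with x hx h0
        exact ge_of_tendsto' (tends x r _) fun k => hx k h0
    have dn : ∀ᵐ x ∂μ, (l ^ (-a x) * r) ^ P x - 1 ≤ 0 → 0 ≤ slack (P x) (a x) M l r := by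
      rcases hMlo.eq_or_lt with h | h
      · refine Filter.Eventually.of_forall fun x hx => ?_
        have h1 := aff x r M (l ^ a x)
        have h2 := mul_nonneg_of_nonpos_of_nonpos (sub_nonpos.2 (h.ge.trans (mem x).1)) hx
        linarith [good x r hr]
      · have h1 : ∀ k : ℕ, ∀ᵐ x ∂μ, (l ^ (-a x) * r) ^ P x - 1 ≤ 0 →
            0 ≤ slack (P x) (a x) (M + (lo - M) * (1 / ((k : ℝ) + 1))) l r := by
          intro k
          obtain ⟨f0, f1⟩ := frac k
          have g1 := mul_pos (sub_pos.2 h) f0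
          have g2 := mul_le_mul_of_nonneg_left f1 (sub_nonneg.2 hMlo)
          obtain ⟨β, hβ, hβ2⟩ := exists_lt_of_lt_csSup (Set.insert_nonempty lo U)
            (show M + (lo - M) * (1 / ((k : ℝ) + 1)) < M by linarith)
          rcases hβ with rfl | ⟨-, s, hs, hβ⟩
          · linarith
          have h3 := (H.measure_slack_neg_eq_zero_or hl hs hr).resolve_left hβ
          filter_upwards [measure_eq_zero_iff_ae_notMem.1 h3] with x hx h0
          have h4 : 0 ≤ slack (P x) (a x) β l r := by
            by_contra hc
            exact hx ⟨h0, not_le.1 hc⟩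
          have h5 := aff x r (M + (lo - M) * (1 / ((k : ℝ) + 1))) β
          have h6 := mul_nonneg_of_nonpos_of_nonpos (sub_nonpos.2 hβ2.le) h0
          linarith
        filter_upwards [ae_all_iff.2 h1] with x hx h0
        exact ge_of_tendsto' (tends x r _) fun k => hx k h0
    filter_upwards [up, dn] with x h1 h2
    rcases le_total 0 ((l ^ (-a x) * r) ^ P x - 1) with h | h
    · exact h1 h
    · exact h2 h
  refine ⟨M, ⟨hMlo, hMhi⟩, ?_⟩
  -- The null set depends on r so far; rational r and continuity in r give one null set for all r.
  have rat : ∀ᵐ x ∂μ, ∀ r : ℚ, 0 ≤ (r : ℝ) → 0 ≤ slack (P x) (a x) M l r := by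
    rw [ae_all_iff]
    intro r
    by_cases hr : 0 ≤ (r : ℝ)
    · filter_upwards [fixed r hr] with x hx _ using hx
    · exact Filter.Eventually.of_forall fun x h => absurd h hr
  filter_upwards [rat] with x hx r hr
  by_contra hc
  have hopen : IsOpen {r | slack (P x) (a x) M l r < 0} :=
    isOpen_lt (continuous_slack (H.P_pos x).le) continuous_const
  obtain ⟨b, c, hbc, hsub⟩ := mem_nhds_iff_exists_Ioo_subset.1 (hopen.mem_nhds (not_le.1 hc))
  obtain ⟨y, hy1, hy2⟩ := exists_rat_btwn hbc.2
  have h1 : slack (P x) (a x) M l y < 0 := hsub ⟨hbc.1.trans hy1, hy2⟩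
  exact absurd (hx y (hr.trans hy1.le)) (not_le.2 h1)

end ConvexLayer

end

end VarMixed

/-! ### Gain at the midpoint when the levels are far apart -/

namespace VarMixed

theorem weight_nonneg {X : Type*} {P a f : X → ℝ} {l : ℝ} (hf0 : ∀ x, 0 ≤ f x) (hl : 0 < l)
    (x : X) : 0 ≤ (l ^ (-a x) * f x) ^ P x :=
  Real.rpow_nonneg (mul_nonneg (Real.rpow_nonneg hl.le _) (hf0 x)) _

section

variable {X : Type*} [MeasurableSpace X] {μ : Measure X} {P a : X → ℝ} {p₀ p₁ a₀ a₁ : ℝ}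

namespace ConvexLayer

variable (H : ConvexLayer μ P a p₀ p₁ a₀ a₁)
include H

theorem exists_gap_nonneg [SigmaFinite μ] {l : ℝ} (hl : 1 < l) :
    ∃ m ∈ Set.Icc (0 : ℝ) 1, ∀ᵐ x ∂μ, 0 ≤ gap (P x) (a x) m l := by
  have hl0 : 0 < l := by linarith
  obtain ⟨M, ⟨hM1, hM2⟩, hM⟩ := H.exists_multiplier hl0
  rw [min_eq_left hl.le] at hM1
  rw [max_eq_right hl.le] at hM2
  have hM0 : 0 < M := by linarith
  refine ⟨Real.logb l M, ⟨Real.logb_nonneg hl hM1, ?_⟩, ?_⟩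
  · rw [Real.logb_le_iff_le_rpow hl hM0]; simpa using hM2
  · filter_upwards [hM] with x hx
    rw [← gap_eq_slack (H.one_lt_P x) hl0, Real.rpow_logb hl0 hl.ne' hM0]
    exact hx _ (by positivity)

/-- The equality analysis needs m' ≤ m. If the multipliers come in the wrong order, m itself also
serves at l': where m < a by `gap_nonneg_of_lt`, and where a ≤ m because l'^m lies between the
multipliers l'^a and l'^m'. -/
theorem exists_gap_nonneg_pair [SigmaFinite μ] {l : ℝ} (hl : 1 < l) :
    ∃ m m' : ℝ, 0 ≤ m' ∧ m' ≤ m ∧ m ≤ 1 ∧ (∀ᵐ x ∂μ, 0 ≤ gap (P x) (a x) m l) ∧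
      ∀ᵐ x ∂μ, 0 ≤ gap (P x) (a x) m' (2 * l / (1 + l)) := by
  have hl' : 1 < 2 * l / (1 + l) := by rw [lt_div_iff₀ (by linarith)]; linarith
  have hll' : 2 * l / (1 + l) < l := by rw [div_lt_iff₀ (by linarith)]; nlinarith
  obtain ⟨m, ⟨hm0, hm1⟩, hm⟩ := H.exists_gap_nonneg hl
  obtain ⟨m', ⟨hm0', hm1'⟩, hm'⟩ := H.exists_gap_nonneg hl'
  rcases le_or_gt m' m with h | h
  · exact ⟨m, m', hm0', h, hm1, hm, hm'⟩
  refine ⟨m, m, hm0, le_rfl, hm1, hm, ?_⟩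
  set l' := 2 * l / (1 + l)
  have hl'0 : 0 < l' := by linarith
  filter_upwards [hm, hm'] with x h1 h2
  rcases lt_or_ge m (a x) with h3 | h3
  · exact gap_nonneg_of_lt (H.one_lt_P x) hm0 h3 (H.a_lt_one x) hl' hll' h1
  · rw [← gap_eq_slack (H.one_lt_P x) hl'0]
    have hr : 0 ≤ l' ^ dualExp (P x) (a x) m := by positivity
    exact slack_nonneg_of_mem_segment (Real.rpow_le_rpow_of_exponent_le hl'.le h3)
      (Real.rpow_le_rpow_of_exponent_le hl'.le h.le)
      (slack_rpow_self_nonneg (H.one_lt_P x).le (H.a_pos x).le (H.a_lt_one x).le hl'0 hr)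
      (slack_nonneg_of_gap (H.one_lt_P x) hl'0 hr h2)

theorem integrable_weight {f : X → ℝ} {l : ℝ} (hf : Measurable f) (hf0 : ∀ x, 0 ≤ f x)
    (h : Adm μ P a f l) : Integrable (fun x => (l ^ (-a x) * f x) ^ P x) μ ∧
      ∫ x, (l ^ (-a x) * f x) ^ P x ∂μ ≤ 1 :=
  integrable_of_lintegral_ofReal_le (H.measurable_weight hf) (weight_nonneg hf0 h.1) h.2

/-- If the level cannot be lowered by the factor 1 - d, the modular is nearly saturated: an integral
below 1 - p₁ d ≤ (1 - d)^p₁ would pay for the lowering. -/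
theorem le_integral_weight_of_not_adm {f : X → ℝ} {l d : ℝ} (hf : Measurable f)
    (hf0 : ∀ x, 0 ≤ f x) (h : Adm μ P a f l) (hd : 0 ≤ d) (hd1 : d < 1) (hp₁ : 1 ≤ p₁)
    (hn : ¬ Adm μ P a f ((1 - d) * l)) : 1 - p₁ * d ≤ ∫ x, (l ^ (-a x) * f x) ^ P x ∂μ := by
  by_contra hlt
  push Not at hlt
  refine hn (H.adm_of_lintegral_le hf0 h.1 (by linarith) (by linarith) ?_)
  rw [← ofReal_integral_eq_lintegral_ofReal (H.integrable_weight hf hf0 h).1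
    (Filter.Eventually.of_forall (weight_nonneg hf0 h.1))]
  refine ENNReal.ofReal_le_ofReal ?_
  have := bernoulli_rpow (x := 1 - d) (by linarith) hp₁
  linarith

/-- The bound g ≤ 2 f makes g vanish with f, so the convention for division by zero does no harm. -/
theorem weight_mul_ratio {f g l k : ℝ} (hf : 0 ≤ f) (hg : 0 ≤ g) (hgf : g ≤ 2 * f) (hl : 0 < l)
    (hk : 0 < k) (x : X) :
    (l ^ (-a x) * f) ^ P x * ((k / l) ^ (-a x) * (g / f)) ^ P x = (k ^ (-a x) * g) ^ P x := by
  rcases hf.eq_or_lt with h | h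
  · have hg0 : g = 0 := by linarith
    rw [← h, hg0]
    simp [(H.P_pos x).ne']
  · rw [← Real.mul_rpow (by positivity) (by positivity), Real.div_rpow hk.le hl.le]
    congr 1
    have : 0 < l ^ (-a x) := by positivity
    field_simp

theorem integral_weight_slack_le {f g : X → ℝ} {l k M κ : ℝ} (hf : Measurable f)
    (hg : Measurable g) (hf0 : ∀ x, 0 ≤ f x) (hg0 : ∀ x, 0 ≤ g x) (hgf : ∀ x, g x ≤ 2 * f x)
    (hAf : Adm μ P a f l) (hAg : Adm μ P a g k)
    (hκ : 1 - κ ≤ ∫ x, (l ^ (-a x) * f x) ^ P x ∂μ) (hM0 : 0 ≤ M) (hM2 : M ≤ 2)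
    (hM : ∀ᵐ x ∂μ, ∀ r, 0 ≤ r → 0 ≤ slack (P x) (a x) M (k / l) r) :
    Integrable (fun x => (l ^ (-a x) * f x) ^ P x * slack (P x) (a x) M (k / l) (g x / f x)) μ ∧
    Integrable (fun x => (l ^ (-a x) * f x) ^ P x *
      (P x * (g x / f x - 1 - a x * (k / l - 1)))) μ ∧
    0 ≤ ∫ x, (l ^ (-a x) * f x) ^ P x * slack (P x) (a x) M (k / l) (g x / f x) ∂μ ∧
    ∫ x, (l ^ (-a x) * f x) ^ P x * slack (P x) (a x) M (k / l) (g x / f x) ∂μ ≤ 2 * κ -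
      ∫ x, (l ^ (-a x) * f x) ^ P x * (P x * (g x / f x - 1 - a x * (k / l - 1))) ∂μ := by
  obtain ⟨iW, W1⟩ := H.integrable_weight hf hf0 hAf
  obtain ⟨iG, G1⟩ := H.integrable_weight hg hg0 hAg
  have hPm := H.measurable_P
  have ham := H.measurable_a
  have hR0 : ∀ x, 0 ≤ g x / f x := fun x => div_nonneg (hg0 x) (hf0 x)
  have hR2 : ∀ x, g x / f x ≤ 2 := fun x => div_le_of_le_mul₀ (hf0 x) (by norm_num) (hgf x)
  have iY := integrable_mul_of_abs_le iW (g := fun x => P x * (g x / f x - 1 - a x * (k / l - 1)))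
    (C := p₁ * (3 + |k / l - 1|)) (by fun_prop) fun x => by
      rw [abs_mul, abs_of_pos (H.P_pos x)]
      refine mul_le_mul (H.P_mem x).2 ?_ (abs_nonneg _) ((H.P_pos x).le.trans (H.P_mem x).2)
      have e1 : |a x * (k / l - 1)| ≤ |k / l - 1| := by
        rw [abs_mul, abs_of_pos (H.a_pos x)]
        exact mul_le_of_le_one_left (abs_nonneg _) (H.a_lt_one x).le
      have e2 := abs_le.1 e1
      rw [abs_le]
      constructor <;> linarith [hR0 x, hR2 x]
  have e : (fun x => (l ^ (-a x) * f x) ^ P x * slack (P x) (a x) M (k / l) (g x / f x)) =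
      fun x => M * ((k ^ (-a x) * g x) ^ P x - (l ^ (-a x) * f x) ^ P x) -
        (l ^ (-a x) * f x) ^ P x * (P x * (g x / f x - 1 - a x * (k / l - 1))) := by
    funext x
    rw [← H.weight_mul_ratio (hf0 x) (hg0 x) (hgf x) hAf.1 hAg.1 x]
    unfold slack
    ring
  have iD : Integrable (fun x => (k ^ (-a x) * g x) ^ P x - (l ^ (-a x) * f x) ^ P x) μ :=
    iG.sub iW
  refine ⟨?_, iY, ?_, ?_⟩
  · rw [e]; exact (iD.const_mul M).sub iY
  · refine integral_nonneg_of_ae ?_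
    filter_upwards [hM] with x hx
    exact mul_nonneg (weight_nonneg hf0 hAf.1 x) (hx _ (hR0 x))
  · rw [e, integral_sub (iD.const_mul M) iY, integral_const_mul, integral_sub iG iW]
    have : M * (∫ x, (k ^ (-a x) * g x) ^ P x ∂μ - ∫ x, (l ^ (-a x) * f x) ^ P x ∂μ) ≤ M * κ :=
      mul_le_mul_of_nonneg_left (by linarith) hM0
    have : M * κ ≤ 2 * κ := mul_le_mul_of_nonneg_right hM2 (by linarith)
    linarith

/-- The increments towards the two ends g and g' are opposite. Each end bounds its own first-order
term from above by 2κ, so together they bound its absolute value, and hence the integrated slack by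
4κ. The end g' uses a multiplier of its own. -/
theorem integral_weight_slack_le_of_midpoint [SigmaFinite μ] {f g g' : X → ℝ} {l k k' M κ : ℝ}
    (hf : Measurable f) (hg : Measurable g) (hg' : Measurable g') (hg0 : ∀ x, 0 ≤ g x)
    (hg0' : ∀ x, 0 ≤ g' x) (hmid : ∀ x, g x + g' x = 2 * f x) (hlk : k + k' = 2 * l)
    (hAf : Adm μ P a f l) (hAg : Adm μ P a g k) (hAg' : Adm μ P a g' k')
    (hκ : 1 - κ ≤ ∫ x, (l ^ (-a x) * f x) ^ P x ∂μ) (hM0 : 0 ≤ M) (hM2 : M ≤ 2)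
    (hM : ∀ᵐ x ∂μ, ∀ r, 0 ≤ r → 0 ≤ slack (P x) (a x) M (k / l) r) :
    Integrable (fun x => (l ^ (-a x) * f x) ^ P x * slack (P x) (a x) M (k / l) (g x / f x)) μ ∧
    Integrable (fun x => (l ^ (-a x) * f x) ^ P x *
      (P x * (g x / f x - 1 - a x * (k / l - 1)))) μ ∧
    |∫ x, (l ^ (-a x) * f x) ^ P x * (P x * (g x / f x - 1 - a x * (k / l - 1))) ∂μ| ≤ 2 * κ ∧
    ∫ x, (l ^ (-a x) * f x) ^ P x * slack (P x) (a x) M (k / l) (g x / f x) ∂μ ≤ 4 * κ := by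
  have hl := hAf.1
  have hf0 : ∀ x, 0 ≤ f x := fun x => by linarith [hg0 x, hg0' x, hmid x]
  obtain ⟨h1, h2, h3, h4⟩ := H.integral_weight_slack_le hf hg hf0 hg0
    (fun x => by linarith [hg0' x, hmid x]) hAf hAg hκ hM0 hM2 hM
  obtain ⟨M', ⟨hM1', hM2'⟩, hM'⟩ := H.exists_multiplier (div_pos hAg'.1 hl)
  have b1 : 0 ≤ M' := le_trans (le_min zero_le_one (div_pos hAg'.1 hl).le) hM1'
  have b2 : M' ≤ 2 := hM2'.trans (max_le one_le_two ((div_le_iff₀ hl).2 (by linarith [hAg.1])))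
  obtain ⟨-, -, h3', h4'⟩ := H.integral_weight_slack_le hf hg' hf0 hg0'
    (fun x => by linarith [hg0 x, hmid x]) hAf hAg' hκ b1 b2 hM'
  have e : (fun x => (l ^ (-a x) * f x) ^ P x * (P x * (g' x / f x - 1 - a x * (k' / l - 1)))) =
      fun x => -((l ^ (-a x) * f x) ^ P x * (P x * (g x / f x - 1 - a x * (k / l - 1)))) := by
    funext x
    rcases (hf0 x).eq_or_lt with h | h
    · rw [← h]; simp [(H.P_pos x).ne']
    · have e1 : g' x / f x = 2 - g x / f x := by
        rw [show g' x = 2 * f x - g x by linarith [hmid x]]; field_simp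
      have e2 : k' / l = 2 - k / l := by
        rw [show k' = 2 * l - k by linarith]; field_simp
      rw [e1, e2]; ring
  rw [e, integral_neg] at h4'
  refine ⟨h1, h2, abs_le.2 ⟨by linarith, by linarith⟩, by linarith⟩

/-- Suppose the midpoint f of u and v gains nothing. Then the midpoint g of f and v gains almost
nothing either, so both slacks towards v have small weighted integrals, as has the first-order term
at f. Integrating `exists_uniform_slack` against the weight of f gives a contradiction. -/
theorem exists_adm_midpoint_of_le [SigmaFinite μ] {η : ℝ} (hη : 0 < η) (hp₁ : 1 ≤ p₁) :
    ∃ δ : ℝ, 0 < δ ∧ δ < 1 ∧ ∀ u v : X → ℝ, ∀ s t : ℝ, Measurable u → Measurable v →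
      (∀ x, 0 ≤ u x) → (∀ x, 0 ≤ v x) → Adm μ P a u s → Adm μ P a v t →
      η * (s + t) ≤ t - s → Adm μ P a (fun x => (u x + v x) / 2) ((1 - δ) * ((s + t) / 2)) := by
  obtain ⟨N, c, hN, hc, hNc⟩ := exists_uniform_slack (p₁ := p₁) H.one_lt H.pos H.lt_one hη
  -- κ Q is the total of the three error terms in the final integration: two slacks of size 4κ, the
  -- second with weight ratio 3^p₁, and the first-order term 2κ.
  set Q : ℝ := 4 * N + 3 ^ p₁ * (4 * N) + 2 with hQ
  have hQ0 : 0 < Q := by positivity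
  set κ : ℝ := min (1 / 2) (c / (4 * Q)) with hκ
  have hκ0 : 0 < κ := lt_min (by norm_num) (by positivity)
  have hκ1 : κ ≤ 1 / 2 := min_le_left _ _
  have hκ2 : κ * Q ≤ c / 4 := by
    have := mul_le_mul_of_nonneg_right (min_le_right (1 / 2) (c / (4 * Q))) hQ0.le
    rw [← hκ] at this
    refine this.trans (le_of_eq ?_)
    field_simp
  have hp₁0 : 0 < p₁ := by linarith
  set δ : ℝ := κ / (2 * p₁) with hδ
  have hδ0 : 0 < δ := by positivity
  have hδκ : p₁ * (2 * δ) = κ := by rw [hδ]; field_simp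
  have hδ1 : δ < 1 / 2 := by nlinarith
  refine ⟨δ, hδ0, by linarith, fun u v s t hu hv hu0 hv0 hAu hAv hst => ?_⟩
  by_contra hcon
  have hs := hAu.1
  have ht := hAv.1
  have hst' : s < t := by nlinarith
  set f : X → ℝ := fun x => (u x + v x) / 2 with hf
  set k : ℝ := (s + t) / 2 with hk
  have hk0 : 0 < k := by positivity
  have mf : Measurable f := by fun_prop
  have f0 : ∀ x, 0 ≤ f x := fun x => by have := hu0 x; have := hv0 x; positivity
  have hAf : Adm μ P a f k := H.convex u v s t hu hv hu0 hv0 hAu hAv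
  set g : X → ℝ := fun x => (f x + v x) / 2 with hg
  set j : ℝ := (k + t) / 2 with hj
  have hj0 : 0 < j := by positivity
  have mg : Measurable g := by fun_prop
  have g0 : ∀ x, 0 ≤ g x := fun x => by have := f0 x; have := hv0 x; positivity
  have hAg : Adm μ P a g j := H.convex f v k t mf hv f0 hv0 hAf hAv
  have J1 : 1 - κ ≤ ∫ x, (k ^ (-a x) * f x) ^ P x ∂μ := by
    have := H.le_integral_weight_of_not_adm mf f0 hAf hδ0.le (by linarith) hp₁ hcon
    nlinarith
  -- f is the midpoint of (u + f)/2 and g. A gain by 1 - 2δ at g would lower the level of f to k - δ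
  -- j ≤ (1 - δ) k.
  have J2 : 1 - κ ≤ ∫ x, (j ^ (-a x) * g x) ^ P x ∂μ := by
    rw [← hδκ]
    refine H.le_integral_weight_of_not_adm mg g0 hAg (by linarith) (by linarith) hp₁ fun hA => ?_
    have h1 := H.convex u f s k hu mf hu0 f0 hAu hAf
    have h2 := H.convex _ g _ _ (by fun_prop) mg
      (fun x => by have := hu0 x; have := f0 x; positivity) g0 h1 hA
    refine hcon (H.adm_mono f0 (fun x => ?_) h2 ?_)
    · simp only [hg, hf]; linarith
    · have : k ≤ j := by rw [hj, hk]; linarith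
      have := mul_le_mul_of_nonneg_left this hδ0.le
      linarith
  set l : ℝ := t / k with hl
  have hl1 : 1 + η ≤ l := by
    rw [hl, le_div_iff₀ hk0, hk]; linarith
  have hl2 : l ≤ 2 := by
    rw [hl, div_le_iff₀ hk0, hk]; linarith
  have hl0 : 0 < l := by positivity
  have hl' : t / j = 2 * l / (1 + l) := by
    rw [hj, hl]; field_simp
  obtain ⟨m, m', hm0', hmm', hm1, hm, hm'⟩ := H.exists_gap_nonneg_pair (l := l) (by linarith)
  have hl'1 : 1 ≤ 2 * l / (1 + l) := by rw [le_div_iff₀ (by linarith)]; linarith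
  have hl'2 : 2 * l / (1 + l) ≤ 2 := by rw [div_le_iff₀ (by linarith)]; linarith
  have hm0 : 0 ≤ m := hm0'.trans hmm'
  have bound : ∀ y e : ℝ, 1 ≤ y → y ≤ 2 → e ≤ 1 → y ^ e ≤ 2 := fun y e hy hy2 he =>
    (Real.rpow_le_rpow_of_exponent_le hy he).trans (by simpa using hy2)
  obtain ⟨i1, i2, n1, n2⟩ := H.integral_weight_slack_le_of_midpoint (M := l ^ m) mf hv hu hv0 hu0
    (fun x => by simp only [hf]; ring) (by rw [hk]; ring) hAf hAv hAu J1 (by positivity)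
    (bound l m (by linarith) hl2 hm1)
    (by
      filter_upwards [hm] with x hx r hr
      exact slack_nonneg_of_gap (H.one_lt_P x) hl0 hr hx)
  obtain ⟨i1', -, -, n2'⟩ := H.integral_weight_slack_le_of_midpoint
    (M := (2 * l / (1 + l)) ^ m') mg hv mf hv0 f0
    (fun x => by simp only [hg]; ring) (by rw [hj]; ring) hAg hAv hAf J2 (by positivity)
    (bound _ m' hl'1 hl'2 (hmm'.trans hm1))
    (by
      filter_upwards [hm'] with x hx r hr
      rw [hl']
      exact slack_nonneg_of_gap (H.one_lt_P x) (by positivity) hr hx)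
  rw [hl'] at i1' n2'
  have key : ∀ᵐ x ∂μ, c * (k ^ (-a x) * f x) ^ P x ≤
      N * ((k ^ (-a x) * f x) ^ P x * slack (P x) (a x) (l ^ m) l (v x / f x)) +
      N * 3 ^ p₁ * ((j ^ (-a x) * g x) ^ P x * slack (P x) (a x) ((2 * l / (1 + l)) ^ m')
        (2 * l / (1 + l)) (v x / g x)) +
      (1 - 2 * m) * ((k ^ (-a x) * f x) ^ P x * (P x * (v x / f x - 1 - a x * (l - 1)))) := by
    filter_upwards [hm, hm'] with x h1 h2
    have W0 := weight_nonneg (P := P) (a := a) g0 hj0 x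
    have S0 : 0 ≤ slack (P x) (a x) ((2 * l / (1 + l)) ^ m') (2 * l / (1 + l)) (v x / g x) :=
      slack_nonneg_of_gap (H.one_lt_P x) (by positivity) (div_nonneg (hv0 x) (g0 x)) h2
    rcases (f0 x).eq_or_lt with h | h
    · rw [← h, mul_zero, Real.zero_rpow (H.P_pos x).ne']
      simp only [mul_zero, zero_mul, zero_add, add_zero]
      positivity
    · have q1 := hNc (P x) (a x) m m' l (v x / f x) (H.P_mem x) (H.a_mem x) hm0' hmm' hm1 hl1 hl2
        (div_nonneg (hv0 x) (f0 x)) ((div_le_iff₀ h).2 (by simp only [hf]; linarith [hu0 x])) h1 h2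
      have q2 : 2 * (v x / f x) / (1 + v x / f x) = v x / g x := by
        have : 0 ≤ v x := hv0 x
        simp only [hg]
        field_simp
      rw [q2] at q1
      -- The two slacks are integrated against different weights. The comparison uses f ≤ 2 g and j
      -- ≤ (3/2) k.
      have q3 : (k ^ (-a x) * f x) ^ P x ≤ 3 ^ p₁ * (j ^ (-a x) * g x) ^ P x := by
        have r1 : k ^ (-a x) ≤ 3 / 2 * j ^ (-a x) := by
          have r2 : j ≤ 3 / 2 * k := by rw [hj, hk]; linarith
          have r3 : j ^ a x ≤ 3 / 2 * k ^ a x := by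
            refine (Real.rpow_le_rpow hj0.le r2 (H.a_pos x).le).trans ?_
            rw [Real.mul_rpow (by norm_num) hk0.le]
            refine mul_le_mul_of_nonneg_right ?_ (by positivity)
            simpa using Real.rpow_le_rpow_of_exponent_le (show (1 : ℝ) ≤ 3 / 2 by norm_num)
              (H.a_lt_one x).le
          rw [Real.rpow_neg hk0.le, Real.rpow_neg hj0.le, ← div_eq_mul_inv,
            le_div_iff₀ (by positivity), inv_mul_eq_div, div_le_iff₀ (by positivity)]
          exact r3
        have r4 : k ^ (-a x) * f x ≤ 3 * (j ^ (-a x) * g x) := by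
          have r5 : f x ≤ 2 * g x := by simp only [hg]; linarith [hv0 x]
          calc k ^ (-a x) * f x ≤ (3 / 2 * j ^ (-a x)) * (2 * g x) :=
                mul_le_mul r1 r5 h.le (by positivity)
            _ = _ := by ring
        calc (k ^ (-a x) * f x) ^ P x ≤ (3 * (j ^ (-a x) * g x)) ^ P x :=
              Real.rpow_le_rpow (by positivity) r4 (H.P_pos x).le
          _ = 3 ^ P x * (j ^ (-a x) * g x) ^ P x :=
              Real.mul_rpow (by norm_num) (mul_nonneg (by positivity) (g0 x))
          _ ≤ _ := mul_le_mul_of_nonneg_right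
              (Real.rpow_le_rpow_of_exponent_le (by norm_num) (H.P_mem x).2) W0
      have q4 := mul_le_mul_of_nonneg_left q1 (weight_nonneg (P := P) (a := a) f0 hk0 x)
      have q5 := mul_le_mul_of_nonneg_left (mul_le_mul_of_nonneg_right q3 S0) hN
      linarith
  have i3 := (i1.const_mul N).fun_add (i1'.const_mul (N * 3 ^ p₁))
  have i4 := i3.fun_add (i2.const_mul (1 - 2 * m))
  have fin := integral_mono_ae ((H.integrable_weight mf f0 hAf).1.const_mul c) i4 key
  rw [integral_const_mul, integral_add i3 (i2.const_mul (1 - 2 * m)),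
    integral_add (i1.const_mul N) (i1'.const_mul (N * 3 ^ p₁)), integral_const_mul,
    integral_const_mul, integral_const_mul] at fin
  have z1 := mul_le_mul_of_nonneg_left n2 hN
  have z2 := mul_le_mul_of_nonneg_left n2' (show 0 ≤ N * 3 ^ p₁ by positivity)
  have z3 : (1 - 2 * m) * ∫ x, (k ^ (-a x) * f x) ^ P x *
      (P x * (v x / f x - 1 - a x * (t / k - 1))) ∂μ ≤ 2 * κ := by
    refine (le_abs_self _).trans ?_
    rw [abs_mul]
    have : |1 - 2 * m| ≤ 1 := abs_le.2 ⟨by linarith, by linarith⟩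
    exact (mul_le_of_le_one_left (abs_nonneg _) this).trans n1
  have z4 := mul_le_mul_of_nonneg_left J1 hc.le
  have z5 : κ * Q = N * (4 * κ) + N * 3 ^ p₁ * (4 * κ) + 2 * κ := by rw [hQ]; ring
  have z6 : c * (1 / 2) ≤ c * (1 - κ) := mul_le_mul_of_nonneg_left (by linarith) hc.le
  linarith

theorem exists_adm_midpoint_of_far [SigmaFinite μ] {η : ℝ} (hη : 0 < η) (hp₁ : 1 ≤ p₁) :
    ∃ δ : ℝ, 0 < δ ∧ δ < 1 ∧ ∀ u v : X → ℝ, ∀ s t : ℝ, Measurable u → Measurable v →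
      (∀ x, 0 ≤ u x) → (∀ x, 0 ≤ v x) → Adm μ P a u s → Adm μ P a v t →
      η * (s + t) ≤ |s - t| → Adm μ P a (fun x => (u x + v x) / 2) ((1 - δ) * ((s + t) / 2)) := by
  obtain ⟨δ, h0, h1, hδ⟩ := H.exists_adm_midpoint_of_le hη hp₁
  refine ⟨δ, h0, h1, fun u v s t hu hv hu0 hv0 hAu hAv hst => ?_⟩
  rcases le_total s t with h | h
  · exact hδ u v s t hu hv hu0 hv0 hAu hAv (by rwa [abs_sub_comm, abs_of_nonneg (by linarith)] at hst)
  · have := hδ v u t s hv hu hv0 hu0 hAv hAu (by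
      rwa [abs_of_nonneg (by linarith), add_comm] at hst)
    simpa only [add_comm] using this

end ConvexLayer

end

end VarMixed

namespace VarMixed

/-! ### Uniform convexity of `z ↦ ‖z‖ ^ p` -/

theorem norm_div_two_rpow_le {𝕜 : Type*} [RCLike 𝕜] {p : ℝ} (hp : 1 ≤ p) (z w : 𝕜) :
    (‖z + w‖ / 2) ^ p ≤ (‖z‖ ^ p + ‖w‖ ^ p) / 2 := by
  have h1 := (convexOn_rpow hp).2 (norm_nonneg z) (norm_nonneg w)
    (show (0 : ℝ) ≤ 1 / 2 by norm_num) (show (0 : ℝ) ≤ 1 / 2 by norm_num) (by norm_num)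
  simp only [smul_eq_mul] at h1
  have h2 : (‖z + w‖ / 2) ^ p ≤ (1 / 2 * ‖z‖ + 1 / 2 * ‖w‖) ^ p :=
    Real.rpow_le_rpow (by positivity) (by linarith [norm_add_le z w]) (by linarith)
  linarith

/-- Strict convexity of the power forces equal norms, and then the parallelogram law forces z = w.
-/
theorem eq_of_norm_div_two_rpow_eq {𝕜 : Type*} [RCLike 𝕜] {p : ℝ} (hp : 1 < p) {z w : 𝕜}
    (h : (‖z + w‖ / 2) ^ p = (‖z‖ ^ p + ‖w‖ ^ p) / 2) : z = w := by
  have h2 : (‖z + w‖ / 2) ^ p ≤ (1 / 2 * ‖z‖ + 1 / 2 * ‖w‖) ^ p :=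
    Real.rpow_le_rpow (by positivity) (by linarith [norm_add_le z w]) (by linarith)
  have h3 : ‖z‖ = ‖w‖ := by
    by_contra hne
    have h1 := (strictConvexOn_rpow hp).2 (norm_nonneg z) (norm_nonneg w) hne
      (show (0 : ℝ) < 1 / 2 by norm_num) (show (0 : ℝ) < 1 / 2 by norm_num) (by norm_num)
    simp only [smul_eq_mul] at h1
    linarith
  have h4 : ‖z + w‖ / 2 = ‖w‖ := by
    rw [h3, add_self_div_two] at h
    exact Real.rpow_left_injOn (by linarith : p ≠ 0) (by positivity : 0 ≤ ‖z + w‖ / 2)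
      (norm_nonneg w) h
  have h5 := parallelogram_law_with_norm 𝕜 z w
  have h6 : ‖z + w‖ = 2 * ‖w‖ := by linarith
  rw [h6, h3] at h5
  have h7 : ‖z - w‖ * ‖z - w‖ = 0 := by linarith
  exact sub_eq_zero.1 (norm_eq_zero.1 (mul_self_eq_zero.1 h7))

/-- By homogeneity it suffices to treat max ‖z‖ ‖w‖ = 1, a compact set also when p varies; there the
convexity defect vanishes only for z = w, where the term with ε dominates. -/
theorem exists_norm_rpow_uniformConvex (𝕜 : Type*) [RCLike 𝕜] {p₀ p₁ ε : ℝ} (hp₀ : 1 < p₀)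
    (hε : 0 < ε) : ∃ δ : ℝ, 0 < δ ∧ ∀ p ∈ Set.Icc p₀ p₁, ∀ z w : 𝕜,
      (‖z + w‖ / 2) ^ p + δ * ‖z - w‖ ^ p ≤ (1 / 2 + δ * ε) * (‖z‖ ^ p + ‖w‖ ^ p) := by
  set K : Set (ℝ × 𝕜 × 𝕜) := (Set.Icc p₀ p₁ ×ˢ Metric.closedBall 0 1 ×ˢ Metric.closedBall 0 1) ∩
    {y | max ‖y.2.1‖ ‖y.2.2‖ = 1} with hK
  have hKc : IsCompact K := (isCompact_Icc.prod ((isCompact_closedBall 0 1).prod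
    (isCompact_closedBall 0 1))).inter_right (isClosed_eq (by fun_prop) continuous_const)
  have hp : ∀ y ∈ K, 1 < y.1 := fun y hy => hp₀.trans_le hy.1.1.1
  have cont : ∀ g : ℝ × 𝕜 × 𝕜 → ℝ, Continuous g → ContinuousOn (fun y => g y ^ y.1) K :=
    fun g hg => hg.continuousOn.rpow continuous_fst.continuousOn
      fun y hy => Or.inr (by linarith [hp y hy])
  have c1 := cont (fun y => ‖y.2.1‖) (by fun_prop)
  have c2 := cont (fun y => ‖y.2.2‖) (by fun_prop)
  have c3 := cont (fun y => ‖y.2.1 + y.2.2‖ / 2) (by fun_prop)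
  have c4 := cont (fun y => ‖y.2.1 - y.2.2‖) (by fun_prop)
  obtain ⟨N, c, hN, hc, h⟩ := hKc.exists_mul_add_ge
    (S := fun y => (‖y.2.1‖ ^ y.1 + ‖y.2.2‖ ^ y.1) / 2 - (‖y.2.1 + y.2.2‖ / 2) ^ y.1)
    (Z := fun y => ε * (‖y.2.1‖ ^ y.1 + ‖y.2.2‖ ^ y.1) - ‖y.2.1 - y.2.2‖ ^ y.1)
    (((c1.add c2).div_const 2).sub c3) (((c1.add c2).const_mul ε).sub c4)
    (fun y hy => sub_nonneg.2 (norm_div_two_rpow_le (hp y hy).le _ _))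
    (fun y hy h0 => by
      have h1 := eq_of_norm_div_two_rpow_eq (hp y hy) (sub_eq_zero.1 h0).symm
      have h2 : max ‖y.2.1‖ ‖y.2.2‖ = 1 := hy.2
      rw [h1, max_self] at h2
      have h3 : y.1 ≠ 0 := by linarith [hp y hy]
      simp only [h1, sub_self, norm_zero, h2, Real.one_rpow, Real.zero_rpow h3]
      linarith)
  refine ⟨(N + 1)⁻¹, by positivity, fun p hpm z w => ?_⟩
  have hp1 : 1 < p := hp₀.trans_le hpm.1
  rcases (le_max_of_le_left (norm_nonneg z) : 0 ≤ max ‖z‖ ‖w‖).eq_or_lt with h0 | h0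
  · have hz : z = 0 := norm_le_zero_iff.1 ((le_max_left _ _).trans h0.ge)
    have hw : w = 0 := norm_le_zero_iff.1 ((le_max_right _ _).trans h0.ge)
    have h3 : p ≠ 0 := by linarith
    simp [hz, hw, Real.zero_rpow h3]
  · set R := max ‖z‖ ‖w‖ with hR
    have nR : ∀ y : 𝕜, ‖((R⁻¹ : ℝ) : 𝕜) * y‖ = R⁻¹ * ‖y‖ := fun y => by
      rw [norm_mul, RCLike.norm_ofReal, abs_of_pos (by positivity)]
    have e2 := nR (z + w)
    have e3 := nR (z - w)
    rw [mul_add] at e2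
    rw [mul_sub] at e3
    have hmem : (p, ((R⁻¹ : ℝ) : 𝕜) * z, ((R⁻¹ : ℝ) : 𝕜) * w) ∈ K := by
      have hz : R⁻¹ * ‖z‖ ≤ 1 := by
        rw [inv_mul_le_iff₀ h0, mul_one]; exact le_max_left _ _
      have hw : R⁻¹ * ‖w‖ ≤ 1 := by
        rw [inv_mul_le_iff₀ h0, mul_one]; exact le_max_right _ _
      refine ⟨⟨hpm, mem_closedBall_zero_iff.2 ((nR z).trans_le hz),
        mem_closedBall_zero_iff.2 ((nR w).trans_le hw)⟩, ?_⟩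
      show max ‖((R⁻¹ : ℝ) : 𝕜) * z‖ ‖((R⁻¹ : ℝ) : 𝕜) * w‖ = 1
      rw [nR, nR, ← mul_max_of_nonneg _ _ (by positivity), ← hR, inv_mul_cancel₀ h0.ne']
    have h1 := h _ hmem
    have hS := norm_div_two_rpow_le hp1.le (((R⁻¹ : ℝ) : 𝕜) * z) (((R⁻¹ : ℝ) : 𝕜) * w)
    simp only [e2, e3, nR, mul_div_assoc] at h1 hS
    have hR' : 0 ≤ R⁻¹ := by positivity
    rw [Real.mul_rpow hR' (norm_nonneg _), Real.mul_rpow hR' (norm_nonneg _),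
      Real.mul_rpow hR' (by positivity)] at hS h1
    rw [Real.mul_rpow hR' (norm_nonneg _)] at h1
    have hRp : 0 < (R⁻¹ : ℝ) ^ p := by positivity
    have h2 : 0 ≤ (R⁻¹ : ℝ) ^ p * ((N + 1) * ((‖z‖ ^ p + ‖w‖ ^ p) / 2 - (‖z + w‖ / 2) ^ p) +
        (ε * (‖z‖ ^ p + ‖w‖ ^ p) - ‖z - w‖ ^ p)) := by linarith
    have h3 := nonneg_of_mul_nonneg_right h2 hRp
    have h4 := mul_nonneg (inv_nonneg.2 (by positivity : 0 ≤ N + 1)) h3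
    have h5 : (N + 1)⁻¹ * ((N + 1) * ((‖z‖ ^ p + ‖w‖ ^ p) / 2 - (‖z + w‖ / 2) ^ p) +
        (ε * (‖z‖ ^ p + ‖w‖ ^ p) - ‖z - w‖ ^ p)) =
        (‖z‖ ^ p + ‖w‖ ^ p) / 2 - (‖z + w‖ / 2) ^ p +
        (N + 1)⁻¹ * (ε * (‖z‖ ^ p + ‖w‖ ^ p) - ‖z - w‖ ^ p) := by
      field_simp
    rw [h5] at h4
    linarith

/-! ### Gain when the levels are close, and uniform convexity of one layer -/

section

variable {X : Type*} [MeasurableSpace X] {μ : Measure X} {P a : X → ℝ} {p₀ p₁ a₀ a₁ : ℝ}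

theorem ExponentBounds.adm_of_integral_le (H : ExponentBounds P a p₀ p₁ a₀ a₁) {f : X → ℝ}
    {l c : ℝ} (hf0 : ∀ x, 0 ≤ f x) (hl : 0 < l) (hc : 0 < c) (hc1 : c ≤ 1)
    (hi : Integrable (fun x => (l ^ (-a x) * f x) ^ P x) μ)
    (h : ∫ x, (l ^ (-a x) * f x) ^ P x ∂μ ≤ c ^ p₁) : Adm μ P a f (c * l) := by
  refine H.adm_of_lintegral_le hf0 hl hc hc1 ?_
  rw [← ofReal_integral_eq_lintegral_ofReal hi
    (Filter.Eventually.of_forall (weight_nonneg hf0 hl))]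
  exact ENNReal.ofReal_le_ofReal h

/-- At the common level L = max s t, either the difference has a small modular, or the pointwise
uniform convexity lowers the modular of the midpoint by a fixed amount, which is converted into a
lower level. -/
theorem ExponentBounds.exists_adm_midpoint_of_near (𝕜 : Type*) [RCLike 𝕜]
    (H : ExponentBounds P a p₀ p₁ a₀ a₁) {ε : ℝ} (hε : 0 < ε) (hp₁ : 1 ≤ p₁) :
    ∃ η : ℝ, 0 < η ∧ η < 1 ∧ ∀ f g : X → 𝕜, ∀ s t : ℝ, Measurable f → Measurable g →
      Adm μ P a (fun x => ‖f x‖) s → Adm μ P a (fun x => ‖g x‖) t → |s - t| ≤ η * (s + t) →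
      Adm μ P a (fun x => ‖f x - g x‖) (ε * (s + t)) ∨
      Adm μ P a (fun x => ‖f x + g x‖ / 2) ((1 - η) * ((s + t) / 2)) := by
  set c : ℝ := min ε 1 with hc
  have hc0 : 0 < c := lt_min hε one_pos
  have hcp : 0 < c ^ p₁ := by positivity
  obtain ⟨δ, hδ, hUC⟩ := exists_norm_rpow_uniformConvex 𝕜 (p₁ := p₁) (ε := c ^ p₁ / 4) H.one_lt
    (by positivity)
  set d : ℝ := min (1 / 2) (δ * c ^ p₁ / (2 * p₁)) with hd
  have hd0 : 0 < d := lt_min (by norm_num) (by positivity)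
  have hd1 : d ≤ 1 / 2 := min_le_left _ _
  have hd2 : p₁ * d ≤ δ * c ^ p₁ / 2 := by
    have := mul_le_mul_of_nonneg_left (min_le_right (1 / 2) (δ * c ^ p₁ / (2 * p₁)))
      (by linarith : 0 ≤ p₁)
    refine this.trans (le_of_eq ?_)
    field_simp
  -- Half of the gain d pays for replacing the mean (s + t)/2 by the maximum: (1 - d)(1 + d/2) ≤ 1 -
  -- d/2.
  refine ⟨d / 2, by linarith, by linarith, fun f g s t hf hg hAf hAg hst => ?_⟩
  have hs := hAf.1
  have ht := hAg.1
  set L := max s t with hL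
  have hL0 : 0 < L := lt_max_of_lt_left hs
  have hL1 : L ≤ s + t := max_le (by linarith) (by linarith)
  have hL2 : L ≤ (1 + d / 2) * ((s + t) / 2) := by
    have := abs_le.1 hst
    exact max_le (by linarith) (by linarith)
  have A1 := H.adm_mono (fun x => norm_nonneg (f x)) (fun x => le_rfl) hAf (le_max_left s t)
  have A2 := H.adm_mono (fun x => norm_nonneg (g x)) (fun x => le_rfl) hAg (le_max_right s t)
  obtain ⟨i1, j1⟩ := integrable_of_lintegral_ofReal_le (H.measurable_weight hf.norm)
    (weight_nonneg (fun x => norm_nonneg (f x)) hL0) A1.2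
  obtain ⟨i2, j2⟩ := integrable_of_lintegral_ofReal_le (H.measurable_weight hg.norm)
    (weight_nonneg (fun x => norm_nonneg (g x)) hL0) A2.2
  have pt : ∀ x, (L ^ (-a x) * (‖f x + g x‖ / 2)) ^ P x + δ * (L ^ (-a x) * ‖f x - g x‖) ^ P x ≤
      (1 / 2 + δ * (c ^ p₁ / 4)) * ((L ^ (-a x) * ‖f x‖) ^ P x + (L ^ (-a x) * ‖g x‖) ^ P x) := by
    intro x
    have h0 : 0 ≤ L ^ (-a x) := by positivity
    have h1 := mul_le_mul_of_nonneg_left (hUC (P x) (H.P_mem x) (f x) (g x))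
      (Real.rpow_nonneg h0 (P x))
    rw [Real.mul_rpow h0 (by positivity), Real.mul_rpow h0 (norm_nonneg _),
      Real.mul_rpow h0 (norm_nonneg _), Real.mul_rpow h0 (norm_nonneg _)]
    linarith
  have m0 : ∀ x, 0 ≤ (L ^ (-a x) * (‖f x + g x‖ / 2)) ^ P x :=
    weight_nonneg (fun x => by positivity) hL0
  have d0 : ∀ x, 0 ≤ (L ^ (-a x) * ‖f x - g x‖) ^ P x :=
    weight_nonneg (fun x => norm_nonneg _) hL0
  have iR := (i1.fun_add i2).const_mul (1 / 2 + δ * (c ^ p₁ / 4))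
  have iM : Integrable (fun x => (L ^ (-a x) * (‖f x + g x‖ / 2)) ^ P x) μ := by
    refine iR.mono' (H.measurable_weight (by fun_prop)).aestronglyMeasurable
      (Filter.Eventually.of_forall fun x => ?_)
    rw [Real.norm_of_nonneg (m0 x)]
    linarith [pt x, mul_nonneg hδ.le (d0 x)]
  have iD : Integrable (fun x => (L ^ (-a x) * ‖f x - g x‖) ^ P x) μ := by
    refine (iR.const_mul δ⁻¹).mono' (H.measurable_weight (by fun_prop)).aestronglyMeasurable
      (Filter.Eventually.of_forall fun x => ?_)
    rw [Real.norm_of_nonneg (d0 x), inv_mul_eq_div, le_div_iff₀ hδ]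
    linarith [pt x, m0 x]
  have hI := integral_mono (iM.fun_add (iD.const_mul δ)) iR pt
  rw [integral_add iM (iD.const_mul δ), integral_const_mul, integral_const_mul,
    integral_add i1 i2] at hI
  have hI2 : (1 / 2 + δ * (c ^ p₁ / 4)) * (∫ x, (L ^ (-a x) * ‖f x‖) ^ P x ∂μ +
      ∫ x, (L ^ (-a x) * ‖g x‖) ^ P x ∂μ) ≤ (1 / 2 + δ * (c ^ p₁ / 4)) * 2 :=
    mul_le_mul_of_nonneg_left (by linarith) (by positivity)
  rcases le_or_gt (∫ x, (L ^ (-a x) * ‖f x - g x‖) ^ P x ∂μ) (c ^ p₁) with hD | hD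
  · left
    refine H.adm_mono (fun x => norm_nonneg _) (fun x => le_rfl)
      (H.adm_of_integral_le (fun x => norm_nonneg _) hL0 hc0 (min_le_right _ _) iD hD) ?_
    exact mul_le_mul (min_le_left _ _) hL1 hL0.le hε.le
  · right
    have hM : ∫ x, (L ^ (-a x) * (‖f x + g x‖ / 2)) ^ P x ∂μ ≤ (1 - d) ^ p₁ := by
      have b := bernoulli_rpow (x := 1 - d) (by linarith) hp₁
      have := mul_lt_mul_of_pos_left hD hδ
      linarith
    refine H.adm_mono (fun x => by positivity) (fun x => le_rfl)
      (H.adm_of_integral_le (fun x => by positivity) hL0 (by linarith) (by linarith) iM hM) ?_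
    have h1 := mul_le_mul_of_nonneg_left hL2 (by linarith : 0 ≤ 1 - d)
    refine h1.trans ?_
    rw [← mul_assoc]
    exact mul_le_mul_of_nonneg_right (by nlinarith) (by positivity)

/-- Either the difference already has a small level, or the midpoint gains a fixed proportion. In
the second case the level of the difference is at most K (s + t)/2, and the factor 1/K in δ lets the
gain absorb it. -/
theorem ConvexLayer.exists_adm_uniformConvex (𝕜 : Type*) [RCLike 𝕜] [SigmaFinite μ]
    (H : ConvexLayer μ P a p₀ p₁ a₀ a₁) {ε : ℝ} (hε : 0 < ε) (hp₁ : 1 ≤ p₁) :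
    ∃ δ : ℝ, 0 < δ ∧ ∀ f g : X → 𝕜, ∀ s t : ℝ, Measurable f → Measurable g →
      Adm μ P a (fun x => ‖f x‖) s → Adm μ P a (fun x => ‖g x‖) t →
      ∃ u w : ℝ, Adm μ P a (fun x => ‖f x + g x‖ / 2) u ∧ Adm μ P a (fun x => ‖f x - g x‖) w ∧
        u + δ * w ≤ (1 / 2 + δ * ε) * (s + t) := by
  obtain ⟨η, hη0, hη1, hnear⟩ := H.exists_adm_midpoint_of_near (μ := μ) 𝕜 hε hp₁
  obtain ⟨δ, hδ0, hδ1, hfar⟩ := H.exists_adm_midpoint_of_far hη0 hp₁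
  set K : ℝ := 2 ^ a₀⁻¹ with hK
  have hK0 : 0 < K := by positivity
  set d : ℝ := min η δ with hd
  have hd0 : 0 < d := lt_min hη0 hδ0
  refine ⟨d / K, by positivity, fun f g s t hf hg hAf hAg => ?_⟩
  have hs := hAf.1
  have ht := hAg.1
  have mid := H.convex _ _ s t hf.norm hg.norm (fun x => norm_nonneg _) (fun x => norm_nonneg _)
    hAf hAg
  have hadd : ∀ x, ‖f x + g x‖ / 2 ≤ (‖f x‖ + ‖g x‖) / 2 := fun x => by
    linarith [norm_add_le (f x) (g x)]
  have hsub : ∀ x, ‖f x - g x‖ ≤ 2 * ((‖f x‖ + ‖g x‖) / 2) := fun x => by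
    linarith [norm_sub_le (f x) (g x)]
  have A1 : Adm μ P a (fun x => ‖f x + g x‖ / 2) ((s + t) / 2) :=
    H.adm_mono (fun x => by positivity) hadd mid le_rfl
  have A2 : Adm μ P a (fun x => ‖f x - g x‖) (K * ((s + t) / 2)) :=
    H.adm_mono (fun x => norm_nonneg _) hsub
      (H.adm_const_mul (fun x => by positivity) one_le_two mid) le_rfl
  have conclude : ∀ τ, d ≤ τ → Adm μ P a (fun x => ‖f x + g x‖ / 2) ((1 - τ) * ((s + t) / 2)) →
      ∃ u w : ℝ, Adm μ P a (fun x => ‖f x + g x‖ / 2) u ∧ Adm μ P a (fun x => ‖f x - g x‖) w ∧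
        u + d / K * w ≤ (1 / 2 + d / K * ε) * (s + t) := fun τ hτ hA => by
    refine ⟨_, _, hA, A2, ?_⟩
    have e : d / K * (K * ((s + t) / 2)) = d * ((s + t) / 2) := by field_simp
    have h1 := mul_le_mul_of_nonneg_right hτ (by positivity : 0 ≤ (s + t) / 2)
    have h2 : 0 ≤ d / K * ε * (s + t) := by positivity
    rw [e]
    linarith
  rcases le_total (|s - t|) (η * (s + t)) with h | h
  · rcases hnear f g s t hf hg hAf hAg h with h1 | h1
    · exact ⟨_, _, A1, h1, by linarith⟩
    · exact conclude η (min_le_left _ _) h1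
  · exact conclude δ (min_le_right _ _) (H.adm_mono (fun x => by positivity) hadd
      (hfar _ _ s t hf.norm hg.norm (fun x => norm_nonneg _) (fun x => norm_nonneg _) hAf hAg h)
      le_rfl)

end

end VarMixed

/-! ### From admissible levels to their infimum -/

namespace VarMixed

section

variable {X : Type*} [MeasurableSpace X] {μ : Measure X} {P a : X → ℝ} {p₀ p₁ a₀ a₁ : ℝ}

/-- The infimum of all `l` for which the modular of `u / l ^ a` in `L^P` is at most one. -/
noncomputable def layerInf (μ : Measure X) (P a : X → ℝ) (u : X → ℝ) : ℝ≥0∞ :=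
  ⨅ (l : ℝ) (_ : Adm μ P a u l), ENNReal.ofReal l

theorem layerInf_le {u : X → ℝ} {l : ℝ} (h : Adm μ P a u l) :
    layerInf μ P a u ≤ ENNReal.ofReal l := iInf₂_le l h

theorem adm_rpow_mul_iff {u : X → ℝ} {c l : ℝ} (hc : 0 < c) (hl : 0 < l) :
    Adm μ P a (fun x => c ^ a x * u x) (c * l) ↔ Adm μ P a u l := by
  have e : ∀ x, (c * l) ^ (-a x) * (c ^ a x * u x) = l ^ (-a x) * u x := fun x => by
    rw [Real.mul_rpow hc.le hl.le, mul_mul_mul_comm, mul_assoc]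
    rw [show c ^ (-a x) * (c ^ a x * (l ^ (-a x) * u x)) =
      (c ^ (-a x) * c ^ a x) * (l ^ (-a x) * u x) by ring, ← Real.rpow_add hc]
    simp
  unfold Adm
  simp_rw [e]
  simp [hc, hl]

theorem ExponentBounds.layerInf_const_mul_le (H : ExponentBounds P a p₀ p₁ a₀ a₁) {u : X → ℝ}
    {c : ℝ} (hu0 : ∀ x, 0 ≤ u x) (hc : 1 ≤ c) :
    layerInf μ P a (fun x => c * u x) ≤ ENNReal.ofReal (c ^ a₀⁻¹) * layerInf μ P a u := by
  have hc0 : 0 < c ^ a₀⁻¹ := Real.rpow_pos_of_pos (by linarith) _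
  conv_rhs => unfold layerInf
  rw [ENNReal.mul_iInf_of_ne (by simpa using hc0) (by simp)]
  refine le_iInf fun l => ?_
  rw [ENNReal.mul_iInf_of_ne (by simpa using hc0) (by simp)]
  refine le_iInf fun hl => ?_
  rw [← ENNReal.ofReal_mul hc0.le]
  exact layerInf_le (H.adm_const_mul hu0 hc hl)

/-- The infimum is attained: passing from the level l / c to l costs only the factor c^(-p₁), which
tends to 1. -/
theorem ExponentBounds.adm_of_layerInf_le (H : ExponentBounds P a p₀ p₁ a₀ a₁) {u : X → ℝ}
    {l : ℝ} (hu0 : ∀ x, 0 ≤ u x) (hl : 0 < l) (h : layerInf μ P a u ≤ ENNReal.ofReal l) :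
    Adm μ P a u l := by
  refine ⟨hl, ?_⟩
  have key : ∀ c ∈ Set.Ioo (0 : ℝ) 1, ∫⁻ x, ENNReal.ofReal ((l ^ (-a x) * u x) ^ P x) ∂μ ≤
      ENNReal.ofReal (c ^ (-p₁)) := by
    rintro c ⟨hc0, hc1⟩
    have hlt : layerInf μ P a u < ENNReal.ofReal (l / c) :=
      h.trans_lt ((ENNReal.ofReal_lt_ofReal_iff (by positivity)).2 (by
        rw [lt_div_iff₀ hc0]; nlinarith))
    simp only [layerInf, iInf_lt_iff] at hlt
    obtain ⟨l', hA, hl'⟩ := hlt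
    have hA2 := H.adm_mono hu0 (fun x => le_rfl) hA
      ((ENNReal.ofReal_lt_ofReal_iff (by positivity)).1 hl').le
    calc ∫⁻ x, ENNReal.ofReal ((l ^ (-a x) * u x) ^ P x) ∂μ
        ≤ ∫⁻ x, ENNReal.ofReal (c ^ (-p₁)) *
            ENNReal.ofReal (((l / c) ^ (-a x) * u x) ^ P x) ∂μ := by
          refine lintegral_mono fun x => ?_
          rw [← ENNReal.ofReal_mul (by positivity)]
          refine ENNReal.ofReal_le_ofReal ?_
          have := H.weight_mul_le (hu0 x) (div_pos hl hc0) hc0 hc1.le x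
          rwa [mul_div_cancel₀ _ hc0.ne'] at this
      _ = ENNReal.ofReal (c ^ (-p₁)) *
            ∫⁻ x, ENNReal.ofReal (((l / c) ^ (-a x) * u x) ^ P x) ∂μ :=
          lintegral_const_mul' _ _ ENNReal.ofReal_ne_top
      _ ≤ ENNReal.ofReal (c ^ (-p₁)) * 1 := by gcongr; exact hA2.2
      _ = _ := mul_one _
  have lim : Filter.Tendsto (fun c : ℝ => ENNReal.ofReal (c ^ (-p₁))) (nhdsWithin 1 (Set.Iio 1))
      (nhds 1) := by
    have h1 : ContinuousAt (fun c : ℝ => c ^ (-p₁)) 1 :=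
      Real.continuousAt_rpow_const _ _ (Or.inl one_ne_zero)
    have h2 := (ENNReal.continuous_ofReal.tendsto _).comp h1.tendsto
    simp only [Real.one_rpow, ENNReal.ofReal_one] at h2
    exact h2.mono_left nhdsWithin_le_nhds
  exact ge_of_tendsto lim (Filter.mem_of_superset (Ioo_mem_nhdsLT zero_lt_one) key)

theorem ConvexLayer.exists_layerInf_uniformConvex (𝕜 : Type*) [RCLike 𝕜] [SigmaFinite μ]
    (H : ConvexLayer μ P a p₀ p₁ a₀ a₁) {ε : ℝ} (hε : 0 < ε) (hp₁ : 1 ≤ p₁) :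
    ∃ δ : ℝ, 0 < δ ∧ ∀ f g : X → 𝕜, Measurable f → Measurable g →
      layerInf μ P a (fun x => ‖f x + g x‖ / 2) +
        ENNReal.ofReal δ * layerInf μ P a (fun x => ‖f x - g x‖) ≤
      ENNReal.ofReal (1 / 2 + δ * ε) *
        (layerInf μ P a (fun x => ‖f x‖) + layerInf μ P a (fun x => ‖g x‖)) := by
  obtain ⟨δ, hδ, h⟩ := H.exists_adm_uniformConvex 𝕜 hε hp₁
  refine ⟨δ, hδ, fun f g hf hg => ?_⟩
  have hC : 0 < 1 / 2 + δ * ε := by positivity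
  have pt : ∀ s t, Adm μ P a (fun x => ‖f x‖) s → Adm μ P a (fun x => ‖g x‖) t →
      layerInf μ P a (fun x => ‖f x + g x‖ / 2) +
        ENNReal.ofReal δ * layerInf μ P a (fun x => ‖f x - g x‖) ≤
      ENNReal.ofReal (1 / 2 + δ * ε) * (ENNReal.ofReal s + ENNReal.ofReal t) := by
    intro s t hs ht
    obtain ⟨u, w, h1, h2, h3⟩ := h f g s t hf hg hs ht
    have h4 := h1.1
    have h5 := h2.1
    have h6 := hs.1
    have h7 := ht.1
    calc _ ≤ ENNReal.ofReal u + ENNReal.ofReal δ * ENNReal.ofReal w := by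
          gcongr
          · exact layerInf_le h1
          · exact layerInf_le h2
      _ = ENNReal.ofReal (u + δ * w) := by
          rw [← ENNReal.ofReal_mul hδ.le, ← ENNReal.ofReal_add h4.le (by positivity)]
      _ ≤ ENNReal.ofReal ((1 / 2 + δ * ε) * (s + t)) := ENNReal.ofReal_le_ofReal h3
      _ = _ := by rw [ENNReal.ofReal_mul hC.le, ENNReal.ofReal_add h6.le h7.le]
  conv_rhs => unfold layerInf
  simp only [ENNReal.iInf_add, ENNReal.add_iInf]
  rw [ENNReal.mul_iInf_of_ne (by simpa using hC) (by simp)]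
  refine le_iInf fun s => ?_
  rw [ENNReal.mul_iInf_of_ne (by simpa using hC) (by simp)]
  refine le_iInf fun hs => ?_
  rw [ENNReal.mul_iInf_of_ne (by simpa using hC) (by simp)]
  refine le_iInf fun t => ?_
  rw [ENNReal.mul_iInf_of_ne (by simpa using hC) (by simp)]
  exact le_iInf fun ht => pt t s ht hs

end

/-! ### Translation to the modular and the norm of the mixed space -/

section Translation

variable {𝕜 : Type*} [RCLike 𝕜] {n : ℕ} {p q : EuclideanSpace ℝ (Fin n) → ℝ≥0∞}
  {P a : EuclideanSpace ℝ (Fin n) → ℝ} {p₀ p₁ a₀ a₁ : ℝ}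

theorem exists_ae_toReal_mem_Icc {r : EuclideanSpace ℝ (Fin n) → ℝ≥0∞}
    (h1 : 1 < essInf r volume) (h2 : essSup r volume < ∞) :
    ∃ c d : ℝ, 1 < c ∧ c ≤ d ∧ ∀ᵐ x, r x ≠ ∞ ∧ (r x).toReal ∈ Set.Icc c d := by
  obtain ⟨c, hc1, hc2⟩ := ENNReal.lt_iff_exists_nnreal_btwn.1 h1
  refine ⟨c, max c (essSup r volume).toReal, by exact_mod_cast hc1, le_max_left _ _, ?_⟩
  filter_upwards [ae_essInf_le (f := r) (μ := volume), ae_le_essSup (f := r) (μ := volume)]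
    with x hx1 hx2
  have hne : r x ≠ ∞ := (hx2.trans_lt h2).ne
  refine ⟨hne, ?_, (ENNReal.toReal_mono h2.ne hx2).trans (le_max_right _ _)⟩
  simpa using ENNReal.toReal_mono hne (hc2.le.trans hx1)

/-- Truncation makes the bounds hold everywhere while changing p and 1/q only on a null set. -/
theorem exists_exponentBounds (hp : IsExponent p) (hq : IsExponent q)
    (hp_inf : 1 < essInf p volume) (hp_sup : essSup p volume < ∞)
    (hq_inf : 1 < essInf q volume) (hq_sup : essSup q volume < ∞) :
    ∃ (P a : EuclideanSpace ℝ (Fin n) → ℝ) (p₀ p₁ a₀ a₁ : ℝ), 1 ≤ p₁ ∧ a₀ ≤ 1 ∧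
      ExponentBounds P a p₀ p₁ a₀ a₁ ∧
      ∀ᵐ x, p x ≠ ∞ ∧ P x = (p x).toReal ∧ a x = ((q x).toReal)⁻¹ := by
  obtain ⟨c, d, hc, hcd, hP⟩ := exists_ae_toReal_mem_Icc hp_inf hp_sup
  obtain ⟨c', d', hc', hcd', hQ⟩ := exists_ae_toReal_mem_Icc hq_inf hq_sup
  have h1 : d'⁻¹ ≤ c'⁻¹ := inv_anti₀ (by linarith) hcd'
  have h2 : c'⁻¹ < 1 := inv_lt_one_of_one_lt₀ hc'
  refine ⟨fun x => max c (min d (p x).toReal), fun x => max d'⁻¹ (min c'⁻¹ ((q x).toReal)⁻¹),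
    c, d, d'⁻¹, c'⁻¹, by linarith, by linarith, ⟨hc, inv_pos.2 (by linarith), h2, ?_, ?_,
    fun x => ⟨le_max_left _ _, max_le hcd (min_le_left _ _)⟩,
    fun x => ⟨le_max_left _ _, max_le h1 (min_le_left _ _)⟩⟩, ?_⟩
  · exact measurable_const.max (measurable_const.min hp.measurable.ennreal_toReal)
  · exact measurable_const.max (measurable_const.min hq.measurable.ennreal_toReal.inv)
  · filter_upwards [hP, hQ] with x ⟨hx1, hx2, hx3⟩ ⟨_, hx4, hx5⟩
    refine ⟨hx1, ?_, ?_⟩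
    · show max c (min d (p x).toReal) = _
      rw [min_eq_right hx3, max_eq_right hx2]
    · show max d'⁻¹ (min c'⁻¹ ((q x).toReal)⁻¹) = _
      rw [min_eq_right (inv_anti₀ (by linarith) hx4),
        max_eq_right (inv_anti₀ (by linarith) hx5)]

theorem layerModular_eq_layerInf
    (h : ∀ᵐ x, p x ≠ ∞ ∧ P x = (p x).toReal ∧ a x = ((q x).toReal)⁻¹)
    (f : EuclideanSpace ℝ (Fin n) → 𝕜) :
    layerModular p q f = layerInf volume P a (fun x => ‖f x‖) := by
  have key : ∀ l : ℝ, 0 < l → lpModular p (fun x => (l ^ ((q x).toReal)⁻¹)⁻¹ • f x) =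
      ∫⁻ x, ENNReal.ofReal ((l ^ (-a x) * ‖f x‖) ^ P x) := by
    intro l hl
    unfold lpModular
    have h0 : volume {x | p x = ∞} = 0 := by
      rw [measure_eq_zero_iff_ae_notMem]
      filter_upwards [h] with x hx using hx.1
    rw [Measure.restrict_eq_zero.2 h0, essSup_measure_zero, Measure.restrict_eq_self_of_ae_mem
      (s := {x | p x ≠ ∞}) (by filter_upwards [h] with x hx using hx.1), bot_eq_zero, add_zero]
    refine lintegral_congr_ae ?_
    filter_upwards [h] with x ⟨_, hP, ha⟩
    rw [← ofReal_norm, ENNReal.ofReal_rpow_of_nonneg (norm_nonneg _) ENNReal.toReal_nonneg,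
      norm_smul, norm_inv, Real.norm_of_nonneg (by positivity), hP, ha, Real.rpow_neg hl.le]
  unfold layerModular layerInf
  refine iInf_congr fun l => iInf_congr_Prop ?_ fun _ => rfl
  unfold Adm
  exact and_congr_right fun hl => by rw [key l hl]

/-- The sequence with first two terms `F`, `G` and all other terms zero. -/
noncomputable def pairSeq (F G : EuclideanSpace ℝ (Fin n) →ₘ[volume] 𝕜) : FunSeq 𝕜 n :=
  fun ν => if ν = 0 then F else if ν = 1 then G else 0

theorem pairSeq_add (F G F' G' : EuclideanSpace ℝ (Fin n) →ₘ[volume] 𝕜) :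
    pairSeq F G + pairSeq F' G' = pairSeq (F + F') (G + G') := by
  funext ν
  simp only [pairSeq, Pi.add_apply]
  split_ifs <;> simp

theorem smul_pairSeq (c : 𝕜) (F G : EuclideanSpace ℝ (Fin n) →ₘ[volume] 𝕜) :
    c • pairSeq F G = pairSeq (c • F) (c • G) := by
  funext ν
  simp only [pairSeq, Pi.smul_apply]
  split_ifs
  · rfl
  · rfl
  · exact smul_zero (A := EuclideanSpace ℝ (Fin n) →ₘ[volume] 𝕜) c

theorem modular_pairSeq (hp : IsExponent p) (F G : EuclideanSpace ℝ (Fin n) →ₘ[volume] 𝕜) :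
    modular p q (pairSeq F G) = layerModular p q F + layerModular p q G := by
  unfold modular
  rw [tsum_eq_sum (s := Finset.range 2)]
  · simp [Finset.sum_range_succ, pairSeq]
  · intro ν hν
    have h1 : ν ≠ 0 := by rintro rfl; simp at hν
    have h2 : ν ≠ 1 := by rintro rfl; simp at hν
    simp only [pairSeq, h1, h2, if_false]
    exact layerModular_zero hp
      (AEEqFun.coeFn_zero (α := EuclideanSpace ℝ (Fin n)) (β := 𝕜) (μ := volume))

namespace ExponentBounds

variable (H : ExponentBounds P a p₀ p₁ a₀ a₁)
  (h : ∀ᵐ x, p x ≠ ∞ ∧ P x = (p x).toReal ∧ a x = ((q x).toReal)⁻¹)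
include H h

theorem modular_smul_le {c : ℝ} (hc : 1 ≤ c) (f : FunSeq 𝕜 n) :
    modular p q ((c : 𝕜) • f) ≤ ENNReal.ofReal (c ^ a₀⁻¹) * modular p q f := by
  unfold modular
  rw [← ENNReal.tsum_mul_left]
  refine ENNReal.tsum_le_tsum fun ν => ?_
  calc layerModular p q (((c : 𝕜) • f) ν)
      ≤ layerModular p q (fun x => (c : 𝕜) * f ν x) := layerModular_mono (by
        filter_upwards [coeFn_smul_seq (c : 𝕜) f ν] with x hx
        rw [hx])
    _ = layerInf volume P a (fun x => c * ‖f ν x‖) := by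
        rw [layerModular_eq_layerInf h]
        simp only [norm_mul, RCLike.norm_ofReal, abs_of_nonneg (zero_le_one.trans hc)]
    _ ≤ _ := by
        rw [layerModular_eq_layerInf h]
        exact H.layerInf_const_mul_le (fun x => norm_nonneg _) hc

theorem luxNorm_le_of_modular_le {c : ℝ} (hc0 : 0 < c) (hc1 : c ≤ 1) {f : FunSeq 𝕜 n}
    (hf : modular p q f ≤ ENNReal.ofReal (c ^ a₀⁻¹)) : luxNorm p q f ≤ ENNReal.ofReal c := by
  refine iInf₂_le c ⟨hc0, ?_⟩
  rw [← RCLike.ofReal_inv]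
  refine (H.modular_smul_le h (one_le_inv_iff₀.2 ⟨hc0, hc1⟩) f).trans ?_
  calc ENNReal.ofReal (c⁻¹ ^ a₀⁻¹) * modular p q f
      ≤ ENNReal.ofReal (c⁻¹ ^ a₀⁻¹) * ENNReal.ofReal (c ^ a₀⁻¹) := by gcongr
    _ = 1 := by
      rw [← ENNReal.ofReal_mul (by positivity), ← Real.mul_rpow (by positivity) hc0.le,
        inv_mul_cancel₀ hc0.ne']
      simp

theorem modular_le_one {f : FunSeq 𝕜 n} (hf : luxNorm p q f ≤ 1) : modular p q f ≤ 1 := by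
  have key : ∀ m ∈ Set.Ioi (1 : ℝ), modular p q f ≤ ENNReal.ofReal (m ^ a₀⁻¹) := by
    intro m hm
    have hm1 : (1 : ℝ) < m := hm
    have hm0 : 0 < m := by linarith
    have hlt : luxNorm p q f < ENNReal.ofReal m := hf.trans_lt (by simpa using hm1)
    simp only [luxNorm, iInf_lt_iff] at hlt
    obtain ⟨m', ⟨hm'0, hm'1⟩, hm'⟩ := hlt
    have hm'2 : m' < m := (ENNReal.ofReal_lt_ofReal_iff hm0).1 hm'
    have h1 : modular p q ((m : 𝕜)⁻¹ • f) ≤ 1 := by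
      refine (modular_smul_mono ?_ f).trans hm'1
      rw [norm_inv, norm_inv, RCLike.norm_ofReal, RCLike.norm_ofReal, abs_of_pos hm0,
        abs_of_pos hm'0]
      exact inv_anti₀ hm'0 hm'2.le
    have h2 := H.modular_smul_le h hm1.le ((m : 𝕜)⁻¹ • f)
    rw [smul_inv_smul₀ (by exact_mod_cast hm0.ne')] at h2
    refine h2.trans ?_
    calc _ ≤ ENNReal.ofReal (m ^ a₀⁻¹) * 1 := by gcongr
      _ = _ := mul_one _
  have lim : Filter.Tendsto (fun m : ℝ => ENNReal.ofReal (m ^ a₀⁻¹))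
      (nhdsWithin 1 (Set.Ioi 1)) (nhds 1) := by
    have h1 : ContinuousAt (fun m : ℝ => m ^ a₀⁻¹) 1 :=
      Real.continuousAt_rpow_const _ _ (Or.inl one_ne_zero)
    have h2 := (ENNReal.continuous_ofReal.tendsto _).comp h1.tendsto
    simp only [Real.one_rpow, ENNReal.ofReal_one] at h2
    exact h2.mono_left nhdsWithin_le_nhds
  exact ge_of_tendsto lim (Filter.mem_of_superset self_mem_nhdsWithin key)

/-- The sequences (F, G) and (G, F) have the same modular, at most 1 after normalization, so their
mean has norm at most 1. Both entries of the mean equal (F + G)/2, hence its level is at most 1/2,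
which is the normalized (s + t)/2. -/
theorem convexLayer (hp : IsExponent p) (htri : TriangleIneq 𝕜 p q) :
    ConvexLayer volume P a p₀ p₁ a₀ a₁ := by
  refine ⟨H, fun u v s t hu hv hu0 hv0 hAu hAv => ?_⟩
  have hs := hAu.1
  have ht := hAv.1
  have ham := H.measurable_a
  -- Multiplying by c^a scales levels by c, so the two levels add up to 1.
  set c : ℝ := (s + t)⁻¹ with hc
  have hc0 : 0 < c := by positivity
  let lift : (EuclideanSpace ℝ (Fin n) → ℝ) → EuclideanSpace ℝ (Fin n) → 𝕜 :=
    fun w x => ((c ^ a x * w x : ℝ) : 𝕜)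
  have mlift : ∀ w, Measurable w → Measurable (lift w) := fun w hw =>
    RCLike.measurable_ofReal.comp ((measurable_const.pow ham).mul hw)
  have nlift : ∀ w : EuclideanSpace ℝ (Fin n) → ℝ, (∀ x, 0 ≤ w x) →
      (fun x => ‖lift w x‖) = fun x => c ^ a x * w x := fun w hw => by
    funext x
    simp only [lift, RCLike.norm_ofReal]
    exact abs_of_nonneg (mul_nonneg (by positivity) (hw x))
  let F : EuclideanSpace ℝ (Fin n) →ₘ[volume] 𝕜 :=
    AEEqFun.mk (lift u) (mlift u hu).aestronglyMeasurable
  let G : EuclideanSpace ℝ (Fin n) →ₘ[volume] 𝕜 :=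
    AEEqFun.mk (lift v) (mlift v hv).aestronglyMeasurable
  have hF : ∀ᵐ x, F x = lift u x := AEEqFun.coeFn_mk _ _
  have hG : ∀ᵐ x, G x = lift v x := AEEqFun.coeFn_mk _ _
  have layer : ∀ w r, (∀ x, 0 ≤ w x) → Adm volume P a w r →
      ∀ W : EuclideanSpace ℝ (Fin n) →ₘ[volume] 𝕜, (∀ᵐ x, W x = lift w x) →
      layerModular p q W ≤ ENNReal.ofReal (c * r) := fun w r hw hA W hW => by
    refine (layerModular_mono (g := lift w) (by filter_upwards [hW] with x hx; rw [hx])).trans ?_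
    rw [layerModular_eq_layerInf h, nlift w hw]
    exact layerInf_le ((adm_rpow_mul_iff hc0 hA.1).2 hA)
  have lF := layer u s hu0 hAu F hF
  have lG := layer v t hv0 hAv G hG
  have hsum : ENNReal.ofReal (c * s) + ENNReal.ofReal (c * t) = 1 := by
    rw [← ENNReal.ofReal_add (by positivity) (by positivity), ← mul_add, hc,
      inv_mul_cancel₀ (by positivity), ENNReal.ofReal_one]
  have M1 : modular p q (pairSeq F G) ≤ 1 := by
    rw [modular_pairSeq hp, ← hsum]; gcongr
  have M2 : modular p q (pairSeq G F) ≤ 1 := by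
    rw [modular_pairSeq hp, ← hsum, add_comm]; gcongr
  have unit : ∀ Φ : FunSeq 𝕜 n, modular p q Φ ≤ 1 → MemMixed p q Φ ∧ luxNorm p q Φ ≤ 1 := by
    intro Φ hΦ
    have e : (((1 : ℝ) : 𝕜)⁻¹) • Φ = Φ := by simp
    refine ⟨⟨1, one_pos, by rw [e]; exact hΦ.trans_lt ENNReal.one_lt_top⟩, ?_⟩
    have := iInf₂_le (f := fun (m : ℝ) (_ : 0 < m ∧ modular p q (((m : 𝕜)⁻¹) • Φ) ≤ 1) =>
      ENNReal.ofReal m) 1 ⟨one_pos, by rw [e]; exact hΦ⟩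
    simpa [luxNorm] using this
  have T := htri _ _ (unit _ M1).1 (unit _ M2).1
  have T2 : luxNorm p q ((2 : 𝕜)⁻¹ • (pairSeq F G + pairSeq G F)) ≤ 1 := by
    rw [luxNorm_smul hp]
    have e : ‖(2 : 𝕜)⁻¹‖ₑ = 2⁻¹ := by
      rw [enorm_inv two_ne_zero, ← ofReal_norm, RCLike.norm_two]; simp
    rw [e]
    calc (2 : ℝ≥0∞)⁻¹ * luxNorm p q (pairSeq F G + pairSeq G F)
        ≤ 2⁻¹ * (1 + 1) := by
          gcongr
          exact T.trans (add_le_add (unit _ M1).2 (unit _ M2).2)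
      _ = 1 := by
          rw [one_add_one_eq_two]; exact ENNReal.inv_mul_cancel two_ne_zero (by simp)
  have T3 := H.modular_le_one h T2
  rw [pairSeq_add, smul_pairSeq, modular_pairSeq hp, add_comm G F, ← two_mul] at T3
  have hmid0 : ∀ x, 0 ≤ (u x + v x) / 2 := fun x => by
    have := hu0 x; have := hv0 x; positivity
  have T4 : layerInf volume P a (fun x => c ^ a x * ((u x + v x) / 2)) ≤
      layerModular p q ((2 : 𝕜)⁻¹ • (F + G)) := by
    rw [← nlift _ hmid0, ← layerModular_eq_layerInf h]
    refine layerModular_mono ?_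
    filter_upwards [AEEqFun.coeFn_smul (2 : 𝕜)⁻¹ (F + G), AEEqFun.coeFn_add F G, hF, hG]
      with x h1 h2 h3 h4
    refine le_of_eq (congrArg _ ?_)
    rw [h1, Pi.smul_apply, h2, Pi.add_apply, h3, h4]
    simp only [lift, smul_eq_mul]
    push_cast
    ring
  have hA : Adm volume P a (fun x => c ^ a x * ((u x + v x) / 2)) (c * ((s + t) / 2)) := by
    refine H.adm_of_layerInf_le (fun x => mul_nonneg (by positivity) (hmid0 x)) (by positivity) ?_
    refine T4.trans ?_
    have e : c * ((s + t) / 2) = 2⁻¹ := by rw [hc]; field_simp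
    rw [e, ENNReal.ofReal_inv_of_pos two_pos, ENNReal.ofReal_ofNat]
    rwa [ENNReal.le_inv_iff_mul_le, mul_comm]
  exact (adm_rpow_mul_iff hc0 (by positivity)).1 hA

end ExponentBounds

theorem ConvexLayer.exists_modular_uniformConvex (H : ConvexLayer volume P a p₀ p₁ a₀ a₁)
    (h : ∀ᵐ x, p x ≠ ∞ ∧ P x = (p x).toReal ∧ a x = ((q x).toReal)⁻¹) (hp₁ : 1 ≤ p₁) {ε : ℝ}
    (hε : 0 < ε) : ∃ δ : ℝ, 0 < δ ∧ ∀ f g : FunSeq 𝕜 n,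
      modular p q ((2 : 𝕜)⁻¹ • (f + g)) + ENNReal.ofReal δ * modular p q (f - g) ≤
      ENNReal.ofReal (1 / 2 + δ * ε) * (modular p q f + modular p q g) := by
  obtain ⟨δ, hδ, hUC⟩ := H.exists_layerInf_uniformConvex 𝕜 hε hp₁
  refine ⟨δ, hδ, fun f g => ?_⟩
  unfold modular
  rw [← ENNReal.tsum_add, ← ENNReal.tsum_mul_left, ← ENNReal.tsum_mul_left, ← ENNReal.tsum_add]
  refine ENNReal.tsum_le_tsum fun ν => ?_
  rw [layerModular_eq_layerInf h (f ν), layerModular_eq_layerInf h (g ν)]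
  refine le_trans (add_le_add ?_ (mul_le_mul_right ?_ _))
    (hUC (f ν) (g ν) (f ν).measurable (g ν).measurable)
  · have e : (fun x => ‖f ν x + g ν x‖ / 2) = fun x => ‖(2 : 𝕜)⁻¹ * (f ν x + g ν x)‖ := by
      funext x
      rw [norm_mul, norm_inv, RCLike.norm_two]; ring
    rw [e, ← layerModular_eq_layerInf h]
    refine layerModular_mono ?_
    filter_upwards [coeFn_smul_seq (2 : 𝕜)⁻¹ (f + g) ν, AEEqFun.coeFn_add (f ν) (g ν)]
      with x h1 h2
    rw [h1, Pi.add_apply, h2, Pi.add_apply]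
  · rw [← layerModular_eq_layerInf h]
    refine layerModular_mono ?_
    filter_upwards [AEEqFun.coeFn_sub (f ν) (g ν)] with x h2
    rw [Pi.sub_apply, h2, Pi.sub_apply]

end Translation

end VarMixed

/-! ### Conclusion: from the modular to the norm -/

theorem mainTheorem1 (𝕜 : Type*) [RCLike 𝕜] (n : ℕ)
    (p q : EuclideanSpace ℝ (Fin n) → ℝ≥0∞)
    (hp : VarMixed.IsExponent p) (hq : VarMixed.IsExponent q)
    (htri : VarMixed.TriangleIneq 𝕜 p q)
    (hp_inf : 1 < essInf p volume) (hp_sup : essSup p volume < ∞)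
    (hq_inf : 1 < essInf q volume) (hq_sup : essSup q volume < ∞) :
    UniformConvexSpace (VarMixed.MixedSpace 𝕜 hp hq htri) := by
  open VarMixed in
  obtain ⟨P, a, p₀, p₁, a₀, a₁, hp₁, ha₀, H, h⟩ :=
    exists_exponentBounds hp hq hp_inf hp_sup hq_inf hq_sup
  have a0pos := H.pos
  have Hc := H.convexLayer h hp htri
  refine ⟨fun ε hε => ?_⟩
  -- Taking c strictly below ε makes a difference of modular less than C = c^(1/a₀) contradict ‖f -
  -- g‖ ≥ ε.
  set c : ℝ := min (ε / 2) (1 / 2) with hc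
  have hc0 : 0 < c := lt_min (by linarith) (by norm_num)
  have hcε : c < ε := (min_le_left _ _).trans_lt (by linarith)
  have hc1 : c ≤ 1 := (min_le_right _ _).trans (by norm_num)
  set C : ℝ := c ^ a₀⁻¹ with hC
  have hC0 : 0 < C := by positivity
  -- With the parameter C/4 the right side is at most 1 + δC/2, while the difference contributes at
  -- least δC on the left; the midpoint keeps 1 - δC/2.
  obtain ⟨δ, hδ, hUC⟩ := Hc.exists_modular_uniformConvex (𝕜 := 𝕜) h hp₁ (ε := C / 4) (by positivity)
  set d : ℝ := min (1 / 2) (a₀ * (δ * C / 2)) with hd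
  have hd0 : 0 < d := lt_min (by norm_num) (by positivity)
  have hd1 : d ≤ 1 / 2 := min_le_left _ _
  have hpow : 1 - δ * C / 2 ≤ (1 - d) ^ a₀⁻¹ := by
    have h1 := bernoulli_rpow (x := 1 - d) (by linarith) (one_le_inv_iff₀.2 ⟨a0pos, ha₀⟩)
    have h2 := mul_le_mul_of_nonneg_left (min_le_right (1 / 2) (a₀ * (δ * C / 2)))
      (inv_nonneg.2 a0pos.le)
    rw [inv_mul_cancel_left₀ a0pos.ne', ← hd] at h2
    linarith
  -- `UniformConvexSpace` bounds ‖f + g‖ by 2 - δ, not the midpoint, hence the factor 2.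
  refine ⟨2 * d, by linarith, fun f hf g hg hfg => ?_⟩
  have unit : ∀ f : MixedSpace 𝕜 hp hq htri, ‖f‖ = 1 → modular p q (f : FunSeq 𝕜 n) ≤ 1 := by
    intro f hf
    refine H.modular_le_one h (le_of_eq ?_)
    rw [← ENNReal.ofReal_toReal (luxNorm_ne_top f), ← MixedSpace.norm_def, hf, ENNReal.ofReal_one]
  have far : ENNReal.ofReal C ≤ modular p q ((f : FunSeq 𝕜 n) - (g : FunSeq 𝕜 n)) := by
    by_contra hlt
    push Not at hlt
    have h1 := H.luxNorm_le_of_modular_le h hc0 hc1 hlt.le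
    rw [← Submodule.coe_sub] at h1
    have h2 := ENNReal.toReal_le_of_le_ofReal hc0.le h1
    rw [← MixedSpace.norm_def] at h2
    linarith
  have mid : modular p q ((2 : 𝕜)⁻¹ • ((f : FunSeq 𝕜 n) + (g : FunSeq 𝕜 n))) ≤
      ENNReal.ofReal ((1 - d) ^ a₀⁻¹) := by
    have h1 : modular p q ((2 : 𝕜)⁻¹ • ((f : FunSeq 𝕜 n) + (g : FunSeq 𝕜 n))) +
        ENNReal.ofReal (δ * C) ≤ ENNReal.ofReal (1 + δ * C / 2) := by
      calc _ ≤ _ + ENNReal.ofReal δ * modular p q ((f : FunSeq 𝕜 n) - (g : FunSeq 𝕜 n)) := by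
            rw [ENNReal.ofReal_mul hδ.le]; gcongr
        _ ≤ _ := hUC f g
        _ ≤ ENNReal.ofReal (1 / 2 + δ * (C / 4)) * (1 + 1) := by
            gcongr
            · exact unit f hf
            · exact unit g hg
        _ = ENNReal.ofReal (1 / 2 + δ * (C / 4)) * ENNReal.ofReal 2 := by
            rw [one_add_one_eq_two, ENNReal.ofReal_ofNat]
        _ = _ := by
            rw [← ENNReal.ofReal_mul (by positivity)]; congr 1; ring
    refine (ENNReal.le_sub_of_add_le_right ENNReal.ofReal_ne_top h1).trans ?_
    rw [← ENNReal.ofReal_sub _ (by positivity)]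
    exact ENNReal.ofReal_le_ofReal (by linarith)
  have h1 := H.luxNorm_le_of_modular_le h (by linarith : 0 < 1 - d) (by linarith) mid
  rw [← Submodule.coe_add, ← Submodule.coe_smul] at h1
  have h2 := ENNReal.toReal_le_of_le_ofReal (by linarith) h1
  rw [← MixedSpace.norm_def, norm_smul, norm_inv, RCLike.norm_two] at h2
  linarith
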